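/- Let $\mathbb D$ be the open unit disc and, for $p\in(0,1)$, let $Co(p)$ be the family of functions $f:\mathbb D\to\overline{\mathbb C}$ such that (i) $f$ is meromorphic in $\mathbb D$ and has a simple pole at $p$; (ii) $f(0)=f'(0)-1=0$; (iii) $f$ maps $\mathbb D$ conformally (injectively) onto a set whose complement with respect to $\overline{\mathbb C}$ is convex. Every $f\in Co(p)$ has a Laurent expansion $$f(z)=\sum_{n=-1}^{\infty}a_n(f)(z-p)^n,\qquad 0<|z-p|<1-p.$$ Let $p\in\left(0,1-\frac{\sqrt2}{2}\right]$. Then the set of values $\{a_1(f): f\in Co(p)\}$ is exactly the closed disc of all $a_1\in\mathbb C$ with $$\left|a_1\left(\frac{1-p^2}{p}\right)^2+\frac{p^2}{1-p^4}\right|\le\frac{1}{1-p^4}.$$ Moreover, for $f\in Co(p)$, equality holds in this inequality with $a_1=a_1(f)$ if and only if there is a $\theta\in[0,2\pi]$ such that $$f(z)=\frac{z-\frac{p}{1+p^2}\left(1+e^{i\theta}\right)z^2}{\left(1-\frac zp\right)(1-zp)},\qquad z\in\mathbb D.$$ -/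

import Mathlib

noncomputable section

namespace ConcaveUnivalent

/-- The map into the Riemann sphere `OnePoint ℂ` given by a meromorphic function `f`: poles are
sent to `∞`, and every other point `z` to `f z`. -/
def toSphere (f : ℂ → ℂ) (z : ℂ) : OnePoint ℂ :=
  open Classical in if meromorphicOrderAt f z < 0 then OnePoint.infty else (f z : OnePoint ℂ)

/-- The class `Co(p)` of concave univalent functions on the open unit disc with pole `p`.
A meromorphic function on the disc is represented by a function `f : ℂ → ℂ`, whose values off
the disc play no role. Meromorphy in normal form says that `f` is analytic at each point of the
disc which is not a pole (there are no removable singularities); the associated map from the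
disc to the Riemann sphere is `toSphere f`. -/
structure IsConcave (p : ℝ) (f : ℂ → ℂ) : Prop where
  meromorphic : MeromorphicNFOn f (Metric.ball 0 1)
  simple_pole : meromorphicOrderAt f (p : ℂ) = -1
  map_zero : f 0 = 0
  deriv_zero : HasDerivAt f 1 0
  injOn : Set.InjOn (toSphere f) (Metric.ball 0 1)
  /-- The complement of the image in the Riemann sphere is a convex subset of the plane
  (it cannot contain `∞`, which is the image of `p`). -/
  convex_compl : ∃ K : Set ℂ, Convex ℝ K ∧
    (toSphere f '' Metric.ball 0 1)ᶜ = (fun w : ℂ => (w : OnePoint ℂ)) '' K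

/-- `Co(p)` as a set of functions. -/
def Co (p : ℝ) : Set (ℂ → ℂ) := {f | IsConcave p f}

/-- The Laurent coefficient `a_n(f)` at the point `p`, `0 < p < 1`, of a function holomorphic on
`0 < |z - p| < 1 - p`, by Cauchy's formula on the circle of radius `(1 - p) / 2`. -/
def laurentCoeff (p : ℝ) (n : ℤ) (f : ℂ → ℂ) : ℂ :=
  (2 * (Real.pi : ℂ) * Complex.I)⁻¹ *
    ∮ z in C((p : ℂ), (1 - p) / 2), f z / (z - (p : ℂ)) ^ (n + 1)

/-- The extremal functions, indexed by `θ`. -/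
def extremal (p θ : ℝ) (z : ℂ) : ℂ :=
  (z - (p : ℂ) / (1 + (p : ℂ) ^ 2) * (1 + Complex.exp (Complex.I * (θ : ℂ))) * z ^ 2) /
    ((1 - z / (p : ℂ)) * (1 - z * (p : ℂ)))

end ConcaveUnivalent

end

/-!
Moving the pole to the origin by a disc automorphism writes `f` as `b * (1 / v + g v)`, and this
map omits a convex set. Inverting about an omitted value `κ` therefore gives a starlike function;
letting `κ` run over boundary values and applying the maximum principle turns starlikeness into a
half-plane condition on every chord joining `η * v` to `v`. Its second-order expansion at `η = 1`
yields `0 ≤ Re ((1 + v² g' + v³ g'') / (1 - v² g'))`, whose Cayley transform is `v² ω` with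
`‖ω‖ ≤ 1` and `ω 0 = g' 0`. Hence, with `c = g' 0`, one has `‖c‖ ≤ 1`, and for `‖v‖ ≤ 1 / 2` the
quantity `v² (g' v - c)` is at most `(2 / 3) (1 - ‖c‖)` in norm.

The normalization `f' 0 = 1` eliminates `b`: up to an affine map, `a₁` is the image of
`c / (1 - p² (g' p - c))` under an automorphism of the disc. The estimate keeps this point in the
closed disc, and on its boundary only if `‖c‖ = 1`, in which case `g` is affine. Conversely, for
affine `g` with `‖c‖ ≤ 1` the omitted set is a filled ellipse, hence convex, and these functions
fill the whole coefficient disc.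
-/

namespace ConcaveUnivalent

open Complex Metric Set Filter Topology

section Univalent

variable {f : ℂ → ℂ} {U : Set ℂ} {z : ℂ}

theorem nhds_le_map_nhds_of_injOn (hf : AnalyticAt ℂ f z) (hU : U ∈ 𝓝 z) (hinj : InjOn f U) :
    𝓝 (f z) ≤ map f (𝓝 z) := by
  refine hf.eventually_constant_or_nhds_le_map_nhds.resolve_left fun hconst => ?_
  obtain ⟨w, ⟨hw, hwU⟩, hwz⟩ := ((hconst.and hU).filter_mono nhdsWithin_le_nhds).and
    (self_mem_nhdsWithin (s := {z}ᶜ)) |>.exists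
  exact hwz (hinj hwU (mem_of_mem_nhds hU) hw)

theorem le_nhds_of_tendsto_of_injOn {l : Filter ℂ} (hf : AnalyticAt ℂ f z) (hU : U ∈ 𝓝 z)
    (hinj : InjOn f U) (hl : U ∈ l) (hlim : Tendsto f l (𝓝 (f z))) : l ≤ 𝓝 z := by
  intro s hs
  have himage : f '' (s ∩ U) ∈ 𝓝 (f z) :=
    nhds_le_map_nhds_of_injOn hf hU hinj (image_mem_map (inter_mem hs hU))
  filter_upwards [hlim himage, hl] with x ⟨y, ⟨hys, hyU⟩, hyx⟩ hxU
  rwa [← hinj hyU hxU hyx]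

theorem isOpen_image_of_injOn (hU : IsOpen U) (hf : AnalyticOnNhd ℂ f U) (hinj : InjOn f U) :
    IsOpen (f '' U) := by
  rw [isOpen_iff_mem_nhds]
  rintro _ ⟨z, hz, rfl⟩
  exact nhds_le_map_nhds_of_injOn (hf z hz) (hU.mem_nhds hz) hinj (image_mem_map (hU.mem_nhds hz))

theorem continuousAt_invFunOn_of_injOn (hU : IsOpen U) (hf : AnalyticOnNhd ℂ f U)
    (hinj : InjOn f U) (hz : z ∈ U) : ContinuousAt (Function.invFunOn f U) (f z) := by
  have himage : f '' U ∈ 𝓝 (f z) :=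
    (isOpen_image_of_injOn hU hf hinj).mem_nhds (mem_image_of_mem f hz)
  rw [ContinuousAt, hinj.leftInvOn_invFunOn hz]
  refine le_nhds_of_tendsto_of_injOn (hf z hz) (hU.mem_nhds hz) hinj ?_ ?_
  · exact mem_map.2 (mem_of_superset himage fun w hw => Function.invFunOn_mem hw)
  · refine tendsto_map'_iff.2 (tendsto_id.congr' ?_)
    filter_upwards [himage] with w hw using (Function.invFunOn_eq hw).symm

theorem eventually_deriv_ne_zero_of_injOn (hf : AnalyticAt ℂ f z) (hU : U ∈ 𝓝 z)
    (hinj : InjOn f U) : ∀ᶠ w in 𝓝[≠] z, deriv f w ≠ 0 := by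
  refine hf.deriv.eventually_eq_zero_or_eventually_ne_zero.resolve_left fun hzero => ?_
  have hconst : ∀ᶠ w in 𝓝 z, f w - f z = 0 := by
    rw [← analyticOrderAt_eq_top, ← hf.analyticOrderAt_deriv_add_one,
      analyticOrderAt_eq_top.2 hzero, top_add]
  obtain ⟨w, ⟨hw, hwU⟩, hwz⟩ := ((hconst.and hU).filter_mono nhdsWithin_le_nhds).and
    (self_mem_nhdsWithin (s := {z}ᶜ)) |>.exists
  exact hwz (hinj hwU (mem_of_mem_nhds hU) (sub_eq_zero.1 hw))

theorem analyticOnNhd_invFunOn_of_injOn (hU : IsOpen U) (hf : AnalyticOnNhd ℂ f U)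
    (hinj : InjOn f U) : AnalyticOnNhd ℂ (Function.invFunOn f U) (f '' U) := by
  rintro _ ⟨z, hz, rfl⟩
  have hcont := fun w hw => continuousAt_invFunOn_of_injOn (z := w) hU hf hinj hw
  have hleft := hinj.leftInvOn_invFunOn
  refine Complex.analyticAt_of_differentiable_on_punctured_nhds_of_continuousAt ?_ (hcont z hz)
  have hopen := isOpen_image_of_injOn hU hf hinj
  have hne : Tendsto (Function.invFunOn f U) (𝓝[≠] f z) (𝓝[≠] z) := by
    refine tendsto_nhdsWithin_iff.2 ⟨?_, ?_⟩
    · simpa only [hleft hz] using (hcont z hz).tendsto.mono_left nhdsWithin_le_nhds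
    · filter_upwards [self_mem_nhdsWithin, nhdsWithin_le_nhds
        (hopen.mem_nhds (mem_image_of_mem f hz))] with w hwz hw hw'
      exact hwz (by rw [← Function.invFunOn_eq hw, hw']; rfl)
  filter_upwards [hne.eventually (eventually_deriv_ne_zero_of_injOn (hf z hz) (hU.mem_nhds hz)
    hinj), nhdsWithin_le_nhds (hopen.mem_nhds (mem_image_of_mem f hz))] with y hy hyU
  obtain ⟨w, hw, rfl⟩ := hyU
  rw [hleft hw] at hy
  refine (HasDerivAt.of_local_left_inverse (f := f) (f' := deriv f w) (hcont w hw) ?_ hy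
    ?_).differentiableAt
  · rw [hleft hw]; exact (hf w hw).differentiableAt.hasDerivAt
  · filter_upwards [hopen.mem_nhds (mem_image_of_mem f hw)] with x hx using Function.invFunOn_eq hx

theorem deriv_invFunOn_mul_deriv (hU : IsOpen U) (hf : AnalyticOnNhd ℂ f U) (hinj : InjOn f U)
    (hz : z ∈ U) : deriv (Function.invFunOn f U) (f z) * deriv f z = 1 := by
  have hinv := analyticOnNhd_invFunOn_of_injOn hU hf hinj _ (mem_image_of_mem f hz)
  have hid : HasDerivAt (Function.invFunOn f U ∘ f) 1 z :=
    (hasDerivAt_id z).congr_of_eventuallyEq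
      (hinj.leftInvOn_invFunOn.eqOn.eventuallyEq_of_mem (hU.mem_nhds hz))
  exact (hinv.differentiableAt.hasDerivAt.comp z (hf z hz).differentiableAt.hasDerivAt).unique hid

theorem deriv_ne_zero_of_injOn (hU : IsOpen U) (hf : AnalyticOnNhd ℂ f U) (hinj : InjOn f U)
    (hz : z ∈ U) : deriv f z ≠ 0 :=
  right_ne_zero_of_mul_eq_one (deriv_invFunOn_mul_deriv hU hf hinj hz)

-- Schwarz's lemma for `w ↦ Q⁻¹ (t * Q w)`.
theorem norm_invFunOn_mul_le_of_starConvex {Q : ℂ → ℂ} (hQ : AnalyticOnNhd ℂ Q (ball 0 1))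
    (hinj : InjOn Q (ball 0 1)) (hQ0 : Q 0 = 0) (hstar : StarConvex ℝ 0 (Q '' ball 0 1))
    {t : ℝ} (ht : t ∈ Icc (0 : ℝ) 1) (hz : z ∈ ball (0 : ℂ) 1) :
    ‖Function.invFunOn Q (ball 0 1) (t * Q z)‖ ≤ ‖z‖ := by
  have hmem : ∀ w ∈ ball (0 : ℂ) 1, (t : ℂ) * Q w ∈ Q '' ball 0 1 := fun w hw => by
    simpa using hstar.smul_mem (mem_image_of_mem Q hw) ht.1 ht.2
  refine norm_le_norm_of_mapsTo_ball (f := fun w => Function.invFunOn Q (ball 0 1) (t * Q w))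
    (R := 1) (fun w hw => ?_)
    (fun w hw => ball_subset_closedBall (Function.invFunOn_mem (hmem w hw))) ?_
    (by simpa using hz)
  · exact ((analyticOnNhd_invFunOn_of_injOn isOpen_ball hQ hinj _ (hmem w hw)).comp
      (f := fun w => (t : ℂ) * Q w)
      (analyticAt_const.mul (hQ w hw))).differentiableAt.differentiableWithinAt
  · simpa [hQ0] using hinj.leftInvOn_invFunOn (mem_ball_self zero_lt_one)

theorem deriv_nonneg_of_eventually_le {φ : ℝ → ℝ} {φ' b : ℝ} (hφ : HasDerivAt φ φ' b)
    (hle : ∀ᶠ t in 𝓝[<] b, φ t ≤ φ b) : 0 ≤ φ' := by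
  have hslope := (hasDerivWithinAt_iff_tendsto_slope' (self_notMem_Iio (a := b))).1
    hφ.hasDerivWithinAt
  refine ge_of_tendsto hslope ?_
  filter_upwards [hle, self_mem_nhdsWithin] with t ht htb
  rw [slope_def_field]
  exact div_nonneg_of_nonpos (sub_nonpos.2 ht) (sub_nonpos.2 (le_of_lt htb))

theorem re_mul_deriv_div_nonneg_of_starConvex {Q : ℂ → ℂ} (hQ : AnalyticOnNhd ℂ Q (ball 0 1))
    (hinj : InjOn Q (ball 0 1)) (hQ0 : Q 0 = 0) (hstar : StarConvex ℝ 0 (Q '' ball 0 1))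
    (hz : z ∈ ball (0 : ℂ) 1) : 0 ≤ (z * deriv Q z / Q z).re := by
  rcases eq_or_ne z 0 with rfl | hz0
  · simp
  set P := Function.invFunOn Q (ball 0 1)
  have hderiv : HasDerivAt (fun t : ℂ => P (t * Q z) / z) (Q z / (z * deriv Q z)) (1 : ℝ) := by
    have hP : HasDerivAt P (deriv P (Q z)) (((1 : ℝ) : ℂ) * Q z) := by
      simpa using (analyticOnNhd_invFunOn_of_injOn isOpen_ball hQ hinj _
        (mem_image_of_mem Q hz)).differentiableAt.hasDerivAt
    have hinv : deriv P (Q z) = 1 / deriv Q z :=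
      eq_one_div_of_mul_eq_one_left (deriv_invFunOn_mul_deriv isOpen_ball hQ hinj hz)
    have hray := (hasDerivAt_id ((1 : ℝ) : ℂ)).mul_const (Q z)
    refine ((hP.comp (h := fun t : ℂ => t * Q z) _ hray).div_const z).congr_deriv ?_
    rw [hinv]
    ring
  have hnonneg : 0 ≤ (Q z / (z * deriv Q z)).re := by
    refine deriv_nonneg_of_eventually_le hderiv.real_of_complex ?_
    filter_upwards [Ioo_mem_nhdsLT (zero_lt_one' ℝ)] with t ht
    have hmax := norm_invFunOn_mul_le_of_starConvex hQ hinj hQ0 hstar (Ioo_subset_Icc_self ht) hz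
    have hPQ : P (Q z) = z := hinj.leftInvOn_invFunOn hz
    rw [ofReal_one, one_mul, hPQ, div_self hz0, one_re]
    exact (re_le_norm _).trans (norm_div (P _) z ▸ div_le_one_of_le₀ hmax (norm_nonneg z))
  rw [← inv_div, inv_re]
  exact div_nonneg hnonneg (normSq_nonneg _)

end Univalent

section MaximumPrinciple

variable {f : ℂ → ℂ} {z : ℂ}

theorem norm_le_of_eventually_norm_le {M : ℝ} (hf : DifferentiableOn ℂ f (ball 0 1))
    (hbdry : ∀ C > M, ∀ᶠ x in comap norm (𝓝[<] 1), ‖f x‖ ≤ C) (hz : z ∈ ball (0 : ℂ) 1) :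
    ‖f z‖ ≤ M := by
  refine le_of_forall_gt_imp_ge_of_dense fun C hC => ?_
  have hnear := eventually_comap.1 (hbdry C hC)
  obtain ⟨r, hr, hzr, hr1⟩ :=
    (hnear.and (Ioo_mem_nhdsLT (mem_ball_zero_iff.1 hz))).exists
  have hsub : closedBall (0 : ℂ) r ⊆ ball 0 1 := closedBall_subset_ball hr1
  refine norm_le_of_forall_mem_frontier_norm_le (U := ball 0 r) isBounded_ball
    (hf.diffContOnCl_ball hsub) (fun x hx => hr x ?_)
    (subset_closure (mem_ball_zero_iff.2 hzr))
  exact mem_sphere_zero_iff_norm.1 (frontier_ball_subset_sphere hx)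

theorem re_nonneg_of_eventually_neg_le_re (hf : DifferentiableOn ℂ f (ball 0 1))
    (hbdry : ∀ ε > 0, ∀ᶠ x in comap norm (𝓝[<] 1), -ε ≤ (f x).re) (hz : z ∈ ball (0 : ℂ) 1) :
    0 ≤ (f z).re := by
  have hexp : ‖exp (-f z)‖ ≤ 1 := by
    refine norm_le_of_eventually_norm_le (f := fun x => exp (-f x)) hf.neg.cexp
      (fun C hC => ?_) hz
    filter_upwards [hbdry (Real.log C) (Real.log_pos hC)] with x hx
    rw [norm_exp, neg_re, ← Real.le_log_iff_exp_le (zero_lt_one.trans hC)]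
    linarith
  rw [norm_exp, Real.exp_le_one_iff, neg_re] at hexp
  linarith

theorem norm_le_one_of_norm_pow_mul_le_one {n : ℕ} (hf : DifferentiableOn ℂ f (ball 0 1))
    (hle : ∀ x ∈ ball (0 : ℂ) 1, ‖x ^ n * f x‖ ≤ 1) (hz : z ∈ ball (0 : ℂ) 1) : ‖f z‖ ≤ 1 := by
  refine norm_le_of_eventually_norm_le hf (fun C hC => ?_) hz
  have hlim : Tendsto (fun r : ℝ => C * r ^ n) (𝓝[<] 1) (𝓝 (C * 1 ^ n)) :=
    ((continuous_const.mul (continuous_pow n)).tendsto 1).mono_left nhdsWithin_le_nhds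
  have hlarge : ∀ᶠ x : ℂ in comap norm (𝓝[<] 1), 1 < C * ‖x‖ ^ n ∧ ‖x‖ ∈ Ioo (0 : ℝ) 1 :=
    tendsto_comap.eventually
      ((hlim.eventually_const_lt (by simpa using hC)).and (Ioo_mem_nhdsLT zero_lt_one))
  filter_upwards [hlarge] with x ⟨hx, hx0, hx1⟩
  have hmul : ‖x‖ ^ n * ‖f x‖ ≤ 1 := by simpa using hle x (mem_ball_zero_iff.2 hx1)
  nlinarith [pow_pos hx0 n]

theorem norm_sub_le_of_norm_le_one (hf : DifferentiableOn ℂ f (ball 0 1))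
    (hle : ∀ x ∈ ball (0 : ℂ) 1, ‖f x‖ ≤ 1) (hz : z ∈ ball (0 : ℂ) 1) :
    ‖f z - f 0‖ ≤ 2 * (1 - ‖f 0‖) * ‖z‖ / (1 - ‖z‖) := by
  have h0 : (0 : ℂ) ∈ ball (0 : ℂ) 1 := mem_ball_self zero_lt_one
  rcases (hle 0 h0).eq_or_lt with hone | hlt
  · have hconst := eqOn_of_isPreconnected_of_isMaxOn_norm
      (convex_ball (0 : ℂ) 1).isPreconnected isOpen_ball hf h0
      (fun x hx => (hle x hx).trans hone.ge) hz
    simp [hconst, hone]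
  obtain ⟨u, hu, hu0⟩ := exists_norm_eq_mul_self (f 0)
  have hre : MapsTo (fun x => u * (f x - f 0)) (ball 0 1) {w | w.re ≤ 1 - ‖f 0‖} := fun x hx => by
    have hux : (u * f x).re ≤ 1 := (re_le_norm _).trans (by simpa [hu] using hle x hx)
    have hsub : (u * (f x - f 0)).re = (u * f x).re - ‖f 0‖ := by
      rw [mul_sub, ← hu0, sub_re, ofReal_re]
    exact hsub.trans_le (by linarith)
  simpa [hu] using borelCaratheodory_zero (sub_pos.2 hlt) (by fun_prop) hre one_pos hz (by simp)

theorem norm_le_of_norm_deriv_le {B B' : ℝ → ℝ}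
    (hf : ∀ x ∈ closedBall (0 : ℂ) ‖z‖, DifferentiableAt ℂ f x) (hf0 : ‖f 0‖ ≤ B 0)
    (hB : ∀ r, HasDerivAt B (B' r) r)
    (hderiv : ∀ x ∈ closedBall (0 : ℂ) ‖z‖, ‖deriv f x‖ ≤ B' ‖x‖) : ‖f z‖ ≤ B ‖z‖ := by
  have hnorm : ∀ t ∈ Icc (0 : ℝ) 1, ‖(t : ℂ) * z‖ = t * ‖z‖ := fun t ht => by
    rw [norm_mul, norm_real, Real.norm_of_nonneg ht.1]
  have hmem : ∀ t ∈ Icc (0 : ℝ) 1, (t : ℂ) * z ∈ closedBall (0 : ℂ) ‖z‖ := fun t ht => by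
    rw [mem_closedBall_zero_iff, hnorm t ht]
    exact mul_le_of_le_one_left (norm_nonneg z) ht.2
  have hray : ∀ t ∈ Icc (0 : ℝ) 1, HasDerivAt (fun s : ℝ => f (s * z)) (deriv f (t * z) * z) t :=
    fun t ht => by
      have hmul : HasDerivAt (fun s : ℂ => s * z) z (t : ℂ) := by
        simpa using (hasDerivAt_id (t : ℂ)).mul_const z
      exact ((hf _ (hmem t ht)).hasDerivAt.comp (t : ℂ) hmul).comp_ofReal
  have hbound := image_norm_le_of_norm_deriv_right_le_deriv_boundary
    (B := fun t : ℝ => B (t * ‖z‖)) (B' := fun t : ℝ => B' (t * ‖z‖) * ‖z‖)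
    (fun t ht => (hray t ht).continuousAt.continuousWithinAt)
    (fun t ht => (hray t (Ico_subset_Icc_self ht)).hasDerivWithinAt) (by simpa using hf0)
    (fun t => by
      simpa [Function.comp_def] using
        (hB (t * ‖z‖)).comp t ((hasDerivAt_id t).mul_const ‖z‖))
    (fun t ht => ?_) (right_mem_Icc.2 zero_le_one)
  · simpa using hbound
  · rw [norm_mul, ← hnorm t (Ico_subset_Icc_self ht)]
    gcongr
    exact hderiv _ (hmem t (Ico_subset_Icc_self ht))

end MaximumPrinciple

/-- The function `v ↦ 1 / v + g v`: a simple pole at the origin with residue `1` and regular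
part `g`. -/
noncomputable def exterior (g : ℂ → ℂ) (v : ℂ) : ℂ := v⁻¹ + g v

/-- The values omitted by `exterior g` on the punctured unit disc. -/
def omitted (g : ℂ → ℂ) : Set ℂ := (exterior g '' (ball 0 1 \ {0}))ᶜ

/-- `exterior g` maps the unit disc conformally onto the exterior of a convex set. Every function
in `Co p` is, up to a constant factor, of this form after a disc automorphism taking `p` to `0`. -/
structure IsConcaveExterior (g : ℂ → ℂ) : Prop where
  analytic : AnalyticOnNhd ℂ g (ball 0 1)
  injOn : InjOn (exterior g) (ball 0 1 \ {0})
  convex_omitted : Convex ℝ (omitted g)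

section Exterior

variable {g : ℂ → ℂ} {v κ : ℂ}

theorem isOpen_ball_diff_zero : IsOpen (ball (0 : ℂ) 1 \ {0}) :=
  isOpen_ball.sdiff isClosed_singleton

theorem not_le_nhds_of_tendsto_norm {l : Filter ℂ} [l.NeBot] (hl : Tendsto norm l (𝓝[<] 1))
    (hv : ‖v‖ < 1) : ¬ l ≤ 𝓝 v := fun hle =>
  hv.ne (tendsto_nhds_unique (continuous_norm.continuousAt.mono_left hle)
    (hl.mono_right nhdsWithin_le_nhds))

theorem inv_mul_one_add_mul_sub (hv : v ≠ 0) : v⁻¹ * (1 + v * (g v - κ)) = exterior g v - κ := by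
  rw [exterior]
  field_simp
  ring

theorem one_sub_add_mul_sub_eq (η : ℂ) (hv : v ≠ 0) :
    1 - η + η * v * (g (η * v) - g v) = 1 + η * v * (g (η * v) - exterior g v) := by
  rw [exterior]
  field_simp
  ring

theorem one_add_mul_sub_ne_zero (hκ : κ ∈ omitted g) (hv : v ∈ ball (0 : ℂ) 1) :
    1 + v * (g v - κ) ≠ 0 := by
  rcases eq_or_ne v 0 with rfl | hv0
  · simp
  intro h
  have hFκ := inv_mul_one_add_mul_sub (g := g) (κ := κ) hv0
  rw [h, mul_zero] at hFκ
  exact hκ ⟨v, ⟨hv, hv0⟩, (sub_eq_zero.1 hFκ.symm)⟩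

/-- The reciprocal `1 / (exterior g v - κ)`, extended by `0` to the pole `v = 0`. -/
noncomputable def invExterior (g : ℂ → ℂ) (κ v : ℂ) : ℂ := v / (1 + v * (g v - κ))

theorem invExterior_zero : invExterior g κ 0 = 0 := zero_div _

theorem invExterior_eq (hv : v ≠ 0) : invExterior g κ v = (exterior g v - κ)⁻¹ := by
  rw [← inv_mul_one_add_mul_sub hv, mul_inv, inv_inv, invExterior, div_eq_mul_inv]

theorem mul_mem_ball {η : ℂ} (hη : ‖η‖ ≤ 1) (hv : v ∈ ball (0 : ℂ) 1) : η * v ∈ ball (0 : ℂ) 1 := by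
  rw [mem_ball_zero_iff, norm_mul]
  exact (mul_le_of_le_one_left (norm_nonneg v) hη).trans_lt (mem_ball_zero_iff.1 hv)

/-- The quotient `-w * F' w / (F w - F v)` for `F = exterior g` and `w = η * v`, in a form which is
regular at `v = 0`. -/
noncomputable def chordQuotient (g : ℂ → ℂ) (η v : ℂ) : ℂ :=
  (1 - (η * v) ^ 2 * deriv g (η * v)) / (1 - η + η * v * (g (η * v) - g v))

namespace IsConcaveExterior

variable (h : IsConcaveExterior g)
include h

theorem analyticOnNhd_exterior : AnalyticOnNhd ℂ (exterior g) (ball 0 1 \ {0}) := fun v hv =>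
  (analyticAt_inv hv.2).add (h.analytic v hv.1)

-- Otherwise the inverse of `exterior g` is a bounded entire function.
theorem nonempty_omitted : (omitted g).Nonempty := by
  by_contra hempty
  set P := Function.invFunOn (exterior g) (ball 0 1 \ {0})
  have himage : ∀ w, w ∈ exterior g '' (ball 0 1 \ {0}) := fun w => by
    by_contra hw
    exact hempty ⟨w, hw⟩
  have hP : Differentiable ℂ P := fun w => (analyticOnNhd_invFunOn_of_injOn isOpen_ball_diff_zero
    h.analyticOnNhd_exterior h.injOn w (himage w)).differentiableAt
  have hbounded : Bornology.IsBounded (range P) := isBounded_ball.subset <|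
    range_subset_iff.2 fun w => (Function.invFunOn_mem (himage w)).1
  have hleft : ∀ x ∈ ball (0 : ℂ) 1 \ {0}, P (exterior g x) = x := h.injOn.leftInvOn_invFunOn
  have hconst := hP.apply_eq_apply_of_bounded hbounded (exterior g (1 / 2)) (exterior g (1 / 3))
  rw [hleft _ (by norm_num), hleft _ (by norm_num)] at hconst
  norm_num at hconst

theorem analyticOnNhd_invExterior (hκ : κ ∈ omitted g) :
    AnalyticOnNhd ℂ (invExterior g κ) (ball 0 1) := fun v hv =>
  analyticAt_id.div (analyticAt_const.add (analyticAt_id.mul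
    ((h.analytic v hv).sub analyticAt_const))) (one_add_mul_sub_ne_zero hκ hv)

theorem injOn_invExterior (hκ : κ ∈ omitted g) : InjOn (invExterior g κ) (ball 0 1) := by
  have hzero : ∀ x ∈ ball (0 : ℂ) 1, invExterior g κ x = 0 → x = 0 := fun x hx hQ =>
    (div_eq_zero_iff.1 hQ).resolve_right (one_add_mul_sub_ne_zero hκ hx)
  intro x hx y hy hxy
  rcases eq_or_ne x 0 with rfl | hx0
  · exact (hzero y hy (hxy.symm.trans invExterior_zero)).symm
  rcases eq_or_ne y 0 with rfl | hy0
  · exact hzero x hx (hxy.trans invExterior_zero)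
  rw [invExterior_eq hx0, invExterior_eq hy0, inv_inj, sub_left_inj] at hxy
  exact h.injOn ⟨hx, hx0⟩ ⟨hy, hy0⟩ hxy

theorem hasDerivAt_invExterior (hκ : κ ∈ omitted g) (hv : v ∈ ball (0 : ℂ) 1) :
    HasDerivAt (invExterior g κ) ((1 - v ^ 2 * deriv g v) / (1 + v * (g v - κ)) ^ 2) v := by
  have hdenom := ((hasDerivAt_id v).mul
    ((h.analytic v hv).differentiableAt.hasDerivAt.sub_const κ)).const_add 1
  refine ((hasDerivAt_id v).div hdenom (one_add_mul_sub_ne_zero hκ hv)).congr_deriv ?_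
  simp only [id_eq, Pi.mul_apply]
  ring

-- Convexity of the omitted set makes the image starlike: multiplying `1 / (y - κ)` by `t < 1`
-- moves `y` away from `κ` along a ray, and a ray that has left the omitted set never returns.
theorem starConvex_image_invExterior (hκ : κ ∈ omitted g) :
    StarConvex ℝ 0 (invExterior g κ '' ball 0 1) := by
  have hzero : (0 : ℂ) ∈ invExterior g κ '' ball 0 1 := ⟨0, by simp, invExterior_zero⟩
  rw [starConvex_zero_iff]
  rintro _ ⟨v, hv, rfl⟩ t ht0 ht1
  rcases eq_or_ne v 0 with rfl | hv0
  · simpa [invExterior_zero] using hzero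
  rcases ht0.eq_or_lt with rfl | htpos
  · simpa using hzero
  have hne : (t : ℂ) ≠ 0 := ofReal_ne_zero.2 htpos.ne'
  have hseg : (1 - t) • κ + t • (κ + (exterior g v - κ) / t) = exterior g v := by
    simp only [real_smul, ofReal_sub, ofReal_one]
    field_simp
    ring
  have himage : κ + (exterior g v - κ) / t ∈ exterior g '' (ball 0 1 \ {0}) := by
    by_contra hy
    have hmem := h.convex_omitted hκ hy (sub_nonneg.2 ht1) ht0 (sub_add_cancel 1 t)
    exact (hseg ▸ hmem) ⟨v, ⟨hv, hv0⟩, rfl⟩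
  obtain ⟨u, ⟨hu, hu0⟩, huy⟩ := himage
  refine ⟨u, hu, ?_⟩
  rw [invExterior_eq hu0, huy, invExterior_eq hv0, add_sub_cancel_left, inv_div, real_smul,
    div_eq_mul_inv]

theorem one_sub_sq_mul_deriv_ne_zero (hv : v ∈ ball (0 : ℂ) 1) : 1 - v ^ 2 * deriv g v ≠ 0 := by
  obtain ⟨κ, hκ⟩ := h.nonempty_omitted
  have hderiv := deriv_ne_zero_of_injOn isOpen_ball (h.analyticOnNhd_invExterior hκ)
    (h.injOn_invExterior hκ) hv
  rw [(h.hasDerivAt_invExterior hκ hv).deriv] at hderiv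
  exact (div_ne_zero_iff.1 hderiv).1

theorem re_div_nonneg_of_mem_omitted (hκ : κ ∈ omitted g) (hv : v ∈ ball (0 : ℂ) 1) :
    0 ≤ ((1 - v ^ 2 * deriv g v) / (1 + v * (g v - κ))).re := by
  rcases eq_or_ne v 0 with rfl | hv0
  · simp
  have hstar := re_mul_deriv_div_nonneg_of_starConvex (h.analyticOnNhd_invExterior hκ)
    (h.injOn_invExterior hκ) invExterior_zero (h.starConvex_image_invExterior hκ) hv
  have hdenom := one_add_mul_sub_ne_zero hκ hv
  rw [(h.hasDerivAt_invExterior hκ hv).deriv, invExterior] at hstar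
  convert hstar using 2
  field_simp

theorem eventually_norm_exterior_sub_le (hκ : κ ∈ omitted g) {l : Ultrafilter ℂ}
    (hl : Tendsto norm (l : Filter ℂ) (𝓝[<] 1)) :
    ∃ C, ∀ᶠ x in (l : Filter ℂ), ‖exterior g x - κ‖ ≤ C := by
  have hball : ball (0 : ℂ) 1 ∈ (l : Filter ℂ) := by
    filter_upwards [hl self_mem_nhdsWithin] with x hx using mem_ball_zero_iff.2 hx
  have hfar : ¬ Tendsto (invExterior g κ) l (𝓝 0) := fun hlim => by
    have hle : (l : Filter ℂ) ≤ 𝓝 0 := le_nhds_of_tendsto_of_injOn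
      (h.analyticOnNhd_invExterior hκ 0 (by simp)) (ball_mem_nhds 0 one_pos)
      (h.injOn_invExterior hκ) hball (by rwa [invExterior_zero])
    exact not_le_nhds_of_tendsto_norm hl (by simp) hle
  obtain ⟨ε, hε, hnear⟩ : ∃ ε > 0, ¬ ∀ᶠ x in (l : Filter ℂ), dist (invExterior g κ x) 0 < ε := by
    simpa only [Metric.tendsto_nhds, not_forall, exists_prop] using hfar
  refine ⟨ε⁻¹, ?_⟩
  filter_upwards [Ultrafilter.eventually_not.2 hnear, hl (Ioo_mem_nhdsLT zero_lt_one)]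
    with x hx hx1
  rw [invExterior_eq (norm_pos_iff.1 hx1.1), dist_zero_right, norm_inv, not_lt] at hx
  exact le_inv_of_le_inv₀ hε hx

theorem exists_tendsto_exterior {l : Ultrafilter ℂ} (hl : Tendsto norm (l : Filter ℂ) (𝓝[<] 1)) :
    ∃ κ ∈ omitted g, Tendsto (exterior g) l (𝓝 κ) := by
  obtain ⟨κ₀, hκ₀⟩ := h.nonempty_omitted
  obtain ⟨C, hC⟩ := h.eventually_norm_exterior_sub_le hκ₀ hl
  obtain ⟨κ, -, hκ⟩ := (isCompact_closedBall κ₀ C).ultrafilter_le_nhds' (l.map (exterior g)) <|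
    Ultrafilter.mem_map.2 (hC.mono fun x hx => mem_closedBall_iff_norm.2 hx)
  refine ⟨κ, ?_, hκ⟩
  rintro ⟨u, hu, rfl⟩
  have hpunctured : ball (0 : ℂ) 1 \ {0} ∈ (l : Filter ℂ) := by
    filter_upwards [hl (Ioo_mem_nhdsLT zero_lt_one)] with x hx
    exact ⟨mem_ball_zero_iff.2 hx.2, norm_pos_iff.1 hx.1⟩
  exact not_le_nhds_of_tendsto_norm hl (mem_ball_zero_iff.1 hu.1) <|
    le_nhds_of_tendsto_of_injOn (h.analyticOnNhd_exterior u hu)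
      (isOpen_ball_diff_zero.mem_nhds hu) h.injOn hpunctured hκ

theorem one_sub_add_mul_sub_ne_zero {η : ℂ} (hη : ‖η‖ ≤ 1) (hη1 : η ≠ 1)
    (hv : v ∈ ball (0 : ℂ) 1) : 1 - η + η * v * (g (η * v) - g v) ≠ 0 := by
  rcases eq_or_ne v 0 with rfl | hv0
  · simpa [sub_eq_zero] using hη1.symm
  rcases eq_or_ne η 0 with rfl | hη0
  · simp
  have hηv := mul_mem_ball hη hv
  have hηv0 : η * v ≠ 0 := mul_ne_zero hη0 hv0
  intro hzero
  have hF := inv_mul_one_add_mul_sub (g := g) (κ := exterior g v) hηv0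
  rw [← one_sub_add_mul_sub_eq η hv0, hzero, mul_zero] at hF
  have hfix : η * v = v := h.injOn ⟨hηv, hηv0⟩ ⟨hv, hv0⟩ (sub_eq_zero.1 hF.symm)
  exact hη1 (mul_right_cancel₀ hv0 (hfix.trans (one_mul v).symm))

theorem analyticAt_chordQuotient {η : ℂ} (hη : ‖η‖ ≤ 1) (hη1 : η ≠ 1) (hv : v ∈ ball (0 : ℂ) 1) :
    AnalyticAt ℂ (Function.uncurry (chordQuotient g)) (η, v) := by
  have hmul : AnalyticAt ℂ (fun q : ℂ × ℂ => q.1 * q.2) (η, v) := analyticAt_fst.mul analyticAt_snd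
  have hg := h.analytic _ (mul_mem_ball hη hv)
  have hnum := analyticAt_const (v := (1 : ℂ)) |>.sub ((hmul.pow 2).mul
    (hg.deriv.comp (f := fun q : ℂ × ℂ => q.1 * q.2) hmul))
  have hdenom := (analyticAt_const (v := (1 : ℂ)) |>.sub analyticAt_fst).add (hmul.mul
    ((hg.comp (f := fun q : ℂ × ℂ => q.1 * q.2) hmul).sub
      ((h.analytic v hv).comp (f := fun q : ℂ × ℂ => q.2) analyticAt_snd)))
  exact hnum.div hdenom (h.one_sub_add_mul_sub_ne_zero hη hη1 hv)

-- As `v` tends to the unit circle, `exterior g v` tends to an omitted value `κ`, and the chord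
-- quotient to the quotient of `re_div_nonneg_of_mem_omitted`.
theorem exists_tendsto_chordQuotient {η : ℂ} (hη : ‖η‖ < 1) {l : Ultrafilter ℂ}
    (hl : Tendsto norm (l : Filter ℂ) (𝓝[<] 1)) :
    ∃ w : ℂ, 0 ≤ w.re ∧ Tendsto (chordQuotient g η) l (𝓝 w) := by
  obtain ⟨κ, hκ, hlim⟩ := h.exists_tendsto_exterior hl
  have hpunctured : ∀ᶠ x in (l : Filter ℂ), ‖x‖ ∈ Ioo (0 : ℝ) 1 := hl (Ioo_mem_nhdsLT one_pos)
  obtain ⟨x₀, hx₀, hlx₀⟩ := (isCompact_closedBall (0 : ℂ) 1).ultrafilter_le_nhds' l <|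
    hpunctured.mono fun x hx => mem_closedBall_zero_iff.2 hx.2.le
  have hmem : η * x₀ ∈ ball (0 : ℂ) 1 := by
    rw [mem_ball_zero_iff, norm_mul]
    exact mul_lt_one_of_nonneg_of_lt_one_left (norm_nonneg η) hη (mem_closedBall_zero_iff.1 hx₀)
  have hmul : Tendsto (fun x => η * x) l (𝓝 (η * x₀)) := tendsto_const_nhds.mul hlx₀
  have hg := h.analytic _ hmem
  refine ⟨_, h.re_div_nonneg_of_mem_omitted hκ hmem, Tendsto.congr' ?_ <| Tendsto.div
    (tendsto_const_nhds.sub ((hmul.pow 2).mul (hg.deriv.continuousAt.tendsto.comp hmul)))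
    (tendsto_const_nhds.add (hmul.mul ((hg.continuousAt.tendsto.comp hmul).sub hlim)))
    (one_add_mul_sub_ne_zero hκ hmem)⟩
  filter_upwards [hpunctured] with x hx
  rw [chordQuotient, one_sub_add_mul_sub_eq η (norm_pos_iff.1 hx.1)]
  rfl

theorem re_chordQuotient_nonneg_of_norm_lt_one {η : ℂ} (hη : ‖η‖ < 1) (hv : v ∈ ball (0 : ℂ) 1) :
    0 ≤ (chordQuotient g η v).re := by
  have hη1 : η ≠ 1 := by
    rintro rfl
    simp at hη
  refine re_nonneg_of_eventually_neg_le_re (fun x hx => (h.analyticAt_chordQuotient hη.le hη1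
    hx).along_snd.differentiableAt.differentiableWithinAt) (fun ε hε => ?_) hv
  refine mem_iff_ultrafilter.2 fun l hl => ?_
  obtain ⟨w, hw, hlim⟩ := h.exists_tendsto_chordQuotient hη (tendsto_iff_comap.2 hl)
  exact (((continuous_re.tendsto w).comp hlim).eventually_const_lt
    ((neg_lt_zero.2 hε).trans_le hw)).mono fun x hx => le_of_lt hx

theorem re_chordQuotient_nonneg {η : ℂ} (hη : ‖η‖ ≤ 1) (hη1 : η ≠ 1) (hv : v ∈ ball (0 : ℂ) 1) :
    0 ≤ (chordQuotient g η v).re := by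
  have hclosure : (𝓝[ball 0 1] η).NeBot := by
    rw [← mem_closure_iff_nhdsWithin_neBot, closure_ball 0 one_ne_zero]
    exact mem_closedBall_zero_iff.2 hη
  have hcont : ContinuousAt (fun ξ => chordQuotient g ξ v) η :=
    (h.analyticAt_chordQuotient hη hη1 hv).along_fst.continuousAt
  have hlim : Tendsto (fun ξ => (chordQuotient g ξ v).re) (𝓝[ball 0 1] η)
      (𝓝 (chordQuotient g η v).re) :=
    (continuous_re.tendsto _).comp (hcont.mono_left nhdsWithin_le_nhds)
  refine ge_of_tendsto hlim ?_
  filter_upwards [self_mem_nhdsWithin] with ξ hξ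
  exact h.re_chordQuotient_nonneg_of_norm_lt_one (mem_ball_zero_iff.1 hξ) hv

end IsConcaveExterior

end Exterior

section SecondOrder

theorem deriv_deriv_nonneg_of_isLocalMin {φ : ℝ → ℝ} {x : ℝ} (hmin : IsLocalMin φ x)
    (hφ : ContinuousAt φ x) : 0 ≤ deriv (deriv φ) x := by
  by_contra! hneg
  have hconst : φ =ᶠ[𝓝 x] fun _ => φ x := by
    filter_upwards [hmin, isLocalMax_of_deriv_deriv_neg hneg hmin.deriv_eq_zero hφ]
      with t ht₁ ht₂ using le_antisymm ht₂ ht₁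
  rw [hconst.deriv.deriv_eq, deriv_const', deriv_const] at hneg
  exact hneg.false

theorem re_deriv_deriv_nonpos_of_isLocalMin {D : ℂ → ℂ} (hD : AnalyticAt ℂ D 0)
    (hmin : IsLocalMin (fun t : ℝ => (D (t * I)).re) 0) : (deriv (deriv D) 0).re ≤ 0 := by
  have htendsto : Tendsto (fun t : ℝ => (t : ℂ) * I) (𝓝 0) (𝓝 0) := by
    have hcont : Continuous fun t : ℝ => (t : ℂ) * I := by fun_prop
    simpa using hcont.tendsto 0
  have hray : ∀ {E : ℂ → ℂ} {t : ℝ}, AnalyticAt ℂ E (t * I) →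
      HasDerivAt (fun s : ℝ => (E (s * I)).re) (deriv E (t * I) * I).re t := fun {E t} hE => by
    have hmul : HasDerivAt (fun s : ℂ => s * I) I (t : ℂ) := by
      simpa using (hasDerivAt_id (t : ℂ)).mul_const I
    exact (hE.differentiableAt.hasDerivAt.comp (t : ℂ) hmul).real_of_complex
  have hfirst : deriv (fun t : ℝ => (D (t * I)).re) =ᶠ[𝓝 0] fun t => (deriv D (t * I) * I).re :=
    (htendsto.eventually hD.eventually_analyticAt).mono fun t ht => (hray ht).deriv
  have hsecond : HasDerivAt (fun t : ℝ => (deriv D (t * I) * I).re)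
      (deriv (deriv D) 0 * I * I).re 0 := by
    have hD' : AnalyticAt ℂ (fun z => deriv D z * I) (((0 : ℝ) : ℂ) * I) := by
      rw [ofReal_zero, zero_mul]
      exact hD.deriv.mul analyticAt_const
    refine (hray hD').congr_deriv ?_
    simp
  have hcont : ContinuousAt (fun t : ℝ => (D (t * I)).re) 0 :=
    (hray (by simpa using hD)).continuousAt
  have hnonneg := deriv_deriv_nonneg_of_isLocalMin hmin hcont
  rw [hfirst.deriv_eq, hsecond.deriv, mul_assoc, I_mul_I, mul_neg_one, neg_re] at hnonneg
  exact neg_nonneg.1 hnonneg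

namespace IsConcaveExterior

variable {g : ℂ → ℂ} {v : ℂ} (h : IsConcaveExterior g)
include h

theorem re_chord_div_nonneg {s : ℂ} (hs : s.re = 0) (hv : v ∈ ball (0 : ℂ) 1) :
    0 ≤ ((1 - exp (-s) + v * (g v - g (v * exp s))) / (1 - v ^ 2 * deriv g v)).re := by
  rcases eq_or_ne (exp (-s)) 1 with hη1 | hη1
  · have hs1 : exp s = 1 := by rw [← inv_inj, ← exp_neg, hη1, inv_one]
    simp [hη1, hs1]
  have hcancel : exp (-s) * (v * exp s) = v := by
    rw [mul_left_comm, ← exp_add, neg_add_cancel, exp_zero, mul_one]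
  have hvs : v * exp s ∈ ball (0 : ℂ) 1 := by
    simpa [norm_exp, hs] using hv
  have hchord := h.re_chordQuotient_nonneg (by simp [norm_exp, hs]) hη1 hvs
  rw [chordQuotient, hcancel] at hchord
  rw [← inv_div, inv_re]
  exact div_nonneg hchord (normSq_nonneg _)

-- Second-order expansion of `re_chord_div_nonneg` at the chord of length zero.
theorem re_one_add_div_nonneg (hv : v ∈ ball (0 : ℂ) 1) :
    0 ≤ ((1 + v ^ 2 * deriv g v + v ^ 3 * deriv (deriv g) v) / (1 - v ^ 2 * deriv g v)).re := by
  set k := 1 - v ^ 2 * deriv g v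
  set D : ℂ → ℂ := fun s => (1 - exp (-s) + v * (g v - g (v * exp s))) / k with hD
  have hexp : ∀ s, HasDerivAt (fun s => v * exp s) (v * exp s) s := fun s =>
    (hasDerivAt_exp s).const_mul v
  have hexpneg : ∀ s, HasDerivAt (fun s => exp (-s)) (-exp (-s)) s := fun s => by
    simpa using (hasDerivAt_neg s).cexp
  have hfirst : ∀ s, v * exp s ∈ ball (0 : ℂ) 1 →
      HasDerivAt D ((exp (-s) - v * (deriv g (v * exp s) * (v * exp s))) / k) s := fun s hs => by
    refine ((((hexpneg s).const_sub 1).add ((((h.analytic _ hs).differentiableAt.hasDerivAt.comp s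
      (hexp s)).const_sub (g v)).const_mul v)).div_const k).congr_deriv ?_
    ring
  have hmem : ∀ᶠ s in 𝓝 (0 : ℂ), v * exp s ∈ ball (0 : ℂ) 1 :=
    (hexp 0).continuousAt.eventually_mem (isOpen_ball.mem_nhds (by simpa using hv))
  have hDan : AnalyticAt ℂ D 0 :=
    analyticAt_iff_eventually_differentiableAt.2
      (hmem.mono fun s hs => (hfirst s hs).differentiableAt)
  have hsecond : HasDerivAt (deriv D)
      (-((1 + v ^ 2 * deriv g v + v ^ 3 * deriv (deriv g) v) / k)) 0 := by
    have hg' : HasDerivAt (fun s => deriv g (v * exp s)) (deriv (deriv g) v * v) 0 := by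
      simpa [Function.comp_def] using (h.analytic _
        (by simpa using hv)).deriv.differentiableAt.hasDerivAt.comp (0 : ℂ) (hexp 0)
    refine ((((hexpneg 0).sub ((hg'.mul (hexp 0)).const_mul v)).div_const k).congr_deriv
      ?_).congr_of_eventuallyEq (hmem.mono fun s hs => (hfirst s hs).deriv)
    simp only [neg_zero, exp_zero, mul_one]
    ring
  have hmin : IsLocalMin (fun t : ℝ => (D (t * I)).re) 0 := Eventually.of_forall fun t => by
    simpa [hD] using h.re_chord_div_nonneg (s := t * I) (by simp) hv
  have hnonpos := re_deriv_deriv_nonpos_of_isLocalMin hDan hmin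
  rw [hsecond.deriv, neg_re] at hnonpos
  exact neg_nonpos.1 hnonpos

end IsConcaveExterior

end SecondOrder

section CoefficientEstimate

theorem norm_le_norm_add_two {q : ℂ} (hq : 0 ≤ (1 + q).re) : ‖q‖ ≤ ‖q + 2‖ := by
  rw [add_re, one_re] at hq
  rw [← sq_le_sq₀ (norm_nonneg _) (norm_nonneg _), ← normSq_eq_norm_sq, ← normSq_eq_norm_sq]
  simp only [normSq_apply, add_re, add_im, re_ofNat, im_ofNat, add_zero]
  linarith

namespace IsConcaveExterior

variable {g : ℂ → ℂ} {v : ℂ} (h : IsConcaveExterior g)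
include h

theorem two_add_ne_zero_and_norm_le (hv : v ∈ ball (0 : ℂ) 1) :
    2 + v ^ 3 * deriv (deriv g) v ≠ 0 ∧
      ‖v ^ 2 * (2 * deriv g v + v * deriv (deriv g) v)‖ ≤ ‖2 + v ^ 3 * deriv (deriv g) v‖ := by
  have hk := h.one_sub_sq_mul_deriv_ne_zero hv
  set k := 1 - v ^ 2 * deriv g v with hk_def
  set q := v ^ 2 * (2 * deriv g v + v * deriv (deriv g) v) / k
  have hqk : v ^ 2 * (2 * deriv g v + v * deriv (deriv g) v) = q * k := (div_mul_cancel₀ _ hk).symm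
  have hq2k : 2 + v ^ 3 * deriv (deriv g) v = (q + 2) * k := by
    linear_combination hqk + 2 * hk_def
  have hre : 0 ≤ (1 + q).re := by
    have hsum : 1 + q = (1 + v ^ 2 * deriv g v + v ^ 3 * deriv (deriv g) v) / k := by
      rw [eq_div_iff hk]
      linear_combination hk_def - hqk
    exact hsum ▸ h.re_one_add_div_nonneg hv
  rw [hqk, hq2k, norm_mul, norm_mul]
  refine ⟨mul_ne_zero (fun hzero => ?_) hk, by gcongr; exact norm_le_norm_add_two hre⟩
  rw [eq_neg_of_add_eq_zero_left hzero] at hre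
  norm_num at hre

-- `v ^ 2 * ω v` is the Cayley transform of the quotient in `re_one_add_div_nonneg`.
theorem exists_schwarz_function :
    ∃ ω : ℂ → ℂ, DifferentiableOn ℂ ω (ball 0 1) ∧ ω 0 = deriv g 0 ∧
      (∀ v ∈ ball (0 : ℂ) 1, ‖ω v‖ ≤ 1) ∧
      ∀ v ∈ ball (0 : ℂ) 1, (1 - v ^ 2 * ω v) * (2 * deriv g v + v * deriv (deriv g) v) =
        2 * ω v * (1 - v ^ 2 * deriv g v) := by
  have hω : DifferentiableOn ℂ (fun v => (2 * deriv g v + v * deriv (deriv g) v) /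
      (2 + v ^ 3 * deriv (deriv g) v)) (ball 0 1) := fun v hv => by
    have hg' := (h.analytic v hv).deriv.differentiableAt
    have hg'' := (h.analytic v hv).deriv.deriv.differentiableAt
    exact DifferentiableAt.differentiableWithinAt
      (DifferentiableAt.fun_div (by fun_prop) (by fun_prop) (h.two_add_ne_zero_and_norm_le hv).1)
  refine ⟨_, hω, by simp, fun v hv => ?_, fun v hv => ?_⟩
  · refine norm_le_one_of_norm_pow_mul_le_one (f := fun v => (2 * deriv g v +
      v * deriv (deriv g) v) / (2 + v ^ 3 * deriv (deriv g) v)) (n := 2) hω (fun z hz => ?_) hv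
    obtain ⟨hne, hle⟩ := h.two_add_ne_zero_and_norm_le hz
    rw [← mul_div_assoc, norm_div]
    exact (div_le_one (norm_pos_iff.2 hne)).2 hle
  · have hne := (h.two_add_ne_zero_and_norm_le hv).1
    field_simp
    ring

theorem norm_deriv_zero_le_one : ‖deriv g 0‖ ≤ 1 := by
  obtain ⟨ω, -, hω0, hω1, -⟩ := h.exists_schwarz_function
  exact hω0 ▸ hω1 0 (mem_ball_self one_pos)

theorem hasDerivAt_sq_mul_deriv_sub (c : ℂ) (hv : v ∈ ball (0 : ℂ) 1) :
    HasDerivAt (fun x => x ^ 2 * (deriv g x - c))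
      (2 * v * (deriv g v - c) + v ^ 2 * deriv (deriv g) v) v := by
  refine ((hasDerivAt_pow 2 v).fun_mul
    ((h.analytic v hv).deriv.differentiableAt.hasDerivAt.sub_const c)).congr_deriv ?_
  push_cast
  ring

theorem norm_deriv_sq_mul_deriv_sub_le (hv : ‖v‖ ≤ 1 / 2) :
    ‖deriv (fun x => x ^ 2 * (deriv g x - deriv g 0)) v‖ ≤
      32 / 3 * (1 - ‖deriv g 0‖) * ‖v‖ ^ 2 + 8 / 3 * ‖v ^ 2 * (deriv g v - deriv g 0)‖ * ‖v‖ := by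
  have hball : v ∈ ball (0 : ℂ) 1 := mem_ball_zero_iff.2 (hv.trans_lt (by norm_num))
  obtain ⟨ω, hω, hω0, hω1, hode⟩ := h.exists_schwarz_function
  have hωv := hω1 v hball
  have hpick : ‖ω v - deriv g 0‖ ≤ 4 * (1 - ‖deriv g 0‖) * ‖v‖ := by
    have hsub := norm_sub_le_of_norm_le_one hω hω1 hball
    rw [hω0] at hsub
    refine hsub.trans ((div_le_iff₀ (by linarith)).2 ?_)
    have hδ := mul_nonneg (sub_nonneg.2 h.norm_deriv_zero_le_one) (norm_nonneg v)
    nlinarith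
  rw [(h.hasDerivAt_sq_mul_deriv_sub _ hball).deriv]
  set E := v ^ 2 * (deriv g v - deriv g 0) with hE
  set E' := 2 * v * (deriv g v - deriv g 0) + v ^ 2 * deriv (deriv g) v with hE'
  have hlinear : (1 - v ^ 2 * ω v) * E' = 2 * v * (ω v - deriv g 0) - 2 * v * ω v * E := by
    simp only [hE, hE']
    linear_combination v * hode v hball
  have hlower : 3 / 4 ≤ ‖1 - v ^ 2 * ω v‖ := by
    have hsmall : ‖v ^ 2 * ω v‖ ≤ 1 / 4 := by
      rw [norm_mul, norm_pow]
      calc ‖v‖ ^ 2 * ‖ω v‖ ≤ (1 / 2) ^ 2 * 1 := by gcongr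
        _ = 1 / 4 := by norm_num
    have hsub := norm_sub_norm_le 1 (v ^ 2 * ω v)
    rw [norm_one] at hsub
    linarith
  have hupper : ‖(1 - v ^ 2 * ω v) * E'‖ ≤
      8 * (1 - ‖deriv g 0‖) * ‖v‖ ^ 2 + 2 * ‖E‖ * ‖v‖ :=
    calc ‖(1 - v ^ 2 * ω v) * E'‖
        ≤ 2 * ‖v‖ * ‖ω v - deriv g 0‖ + 2 * ‖v‖ * ‖ω v‖ * ‖E‖ := by
          rw [hlinear]
          exact (norm_sub_le _ _).trans_eq (by simp only [norm_mul, norm_ofNat])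
      _ ≤ 2 * ‖v‖ * (4 * (1 - ‖deriv g 0‖) * ‖v‖) + 2 * ‖v‖ * 1 * ‖E‖ := by gcongr
      _ = _ := by ring
  rw [norm_mul] at hupper
  linarith [mul_le_mul_of_nonneg_right hlower (norm_nonneg E')]

-- At a point `v₀` maximizing `‖E‖`, integrating `norm_deriv_sq_mul_deriv_sub_le` from `0` to `v₀`
-- bounds `‖E v₀‖` by `4 / 9 * δ + ‖E v₀‖ / 3`.
theorem norm_sq_mul_deriv_sub_le (hv : ‖v‖ ≤ 1 / 2) :
    ‖v ^ 2 * (deriv g v - deriv g 0)‖ ≤ 2 / 3 * (1 - ‖deriv g 0‖) := by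
  set E : ℂ → ℂ := fun x => x ^ 2 * (deriv g x - deriv g 0)
  have hE : ∀ x ∈ closedBall (0 : ℂ) (1 / 2), DifferentiableAt ℂ E x := fun x hx =>
    (h.hasDerivAt_sq_mul_deriv_sub _
      (closedBall_subset_ball (by norm_num) hx)).differentiableAt
  obtain ⟨v₀, hv₀, hmax⟩ := (isCompact_closedBall (0 : ℂ) (1 / 2)).exists_isMaxOn
    ⟨0, mem_closedBall_self (by norm_num)⟩ (f := fun x => ‖E x‖)
    (fun x hx => (hE x hx).continuousAt.norm.continuousWithinAt)
  have hδ := sub_nonneg.2 h.norm_deriv_zero_le_one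
  set δ := 1 - ‖deriv g 0‖
  have hv₀' := mem_closedBall_zero_iff.1 hv₀
  have hsub := closedBall_subset_closedBall (x := (0 : ℂ)) hv₀'
  have hself := norm_le_of_norm_deriv_le (f := E) (z := v₀)
    (B := fun r => 32 / 9 * δ * r ^ 3 + 4 / 3 * ‖E v₀‖ * r ^ 2)
    (B' := fun r => 32 / 3 * δ * r ^ 2 + 8 / 3 * ‖E v₀‖ * r)
    (fun x hx => hE x (hsub hx)) (by simp [E])
    (fun r => (((hasDerivAt_pow 3 r).const_mul _).add
      ((hasDerivAt_pow 2 r).const_mul _)).congr_deriv (by push_cast; ring))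
    (fun x hx => (h.norm_deriv_sq_mul_deriv_sub_le (mem_closedBall_zero_iff.1 (hsub hx))).trans
      (by gcongr; exact hmax (hsub hx)))
  have hmaximum : ‖E v₀‖ ≤ 2 / 3 * δ := by
    have hradius : 32 / 9 * δ * ‖v₀‖ ^ 3 + 4 / 3 * ‖E v₀‖ * ‖v₀‖ ^ 2 ≤
        32 / 9 * δ * (1 / 2) ^ 3 + 4 / 3 * ‖E v₀‖ * (1 / 2) ^ 2 := by gcongr
    linarith
  exact (hmax (mem_closedBall_zero_iff.2 hv)).trans hmaximum

theorem deriv_eqOn_const_of_norm_deriv_zero_eq_one (hone : ‖deriv g 0‖ = 1) :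
    EqOn (deriv g) (fun _ => deriv g 0) (ball 0 1) := by
  refine h.analytic.deriv.eqOn_of_preconnected_of_eventuallyEq (fun _ _ => analyticAt_const)
    (convex_ball _ _).isPreconnected (mem_ball_self one_pos) ?_
  filter_upwards [closedBall_mem_nhds (0 : ℂ) (by norm_num : (0 : ℝ) < 1 / 2)] with v hv
  rcases eq_or_ne v 0 with rfl | hv0
  · rfl
  have hle := h.norm_sq_mul_deriv_sub_le (mem_closedBall_zero_iff.1 hv)
  rw [hone, sub_self, mul_zero, norm_le_zero_iff] at hle
  exact sub_eq_zero.1 ((mul_eq_zero.1 hle).resolve_left (pow_ne_zero 2 hv0))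

end IsConcaveExterior

end CoefficientEstimate

section DiscAut

theorem norm_one_sub_mul_sq_sub_norm_sub_sq (a : ℝ) (z : ℂ) :
    ‖1 - a * z‖ ^ 2 - ‖a - z‖ ^ 2 = (1 - a ^ 2) * (1 - ‖z‖ ^ 2) := by
  simp only [← normSq_eq_norm_sq, normSq_apply, sub_re, sub_im, re_ofReal_mul, im_ofReal_mul,
    one_re, one_im, ofReal_re, ofReal_im]
  ring

/-- The involutive automorphism `z ↦ (p - z) / (1 - p z)` of the unit disc, which exchanges `0` and
`p`. It moves the pole of a function in `Co p` to the origin. -/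
noncomputable def discAut (p : ℝ) (z : ℂ) : ℂ := (p - z) / (1 - p * z)

variable {p : ℝ} {z : ℂ}

theorem discAut_self (p : ℝ) : discAut p p = 0 := by
  rw [discAut, sub_self, zero_div]

theorem discAut_zero (p : ℝ) : discAut p 0 = p := by
  rw [discAut, mul_zero, sub_zero, sub_zero, div_one]

theorem one_sub_mul_ne_zero (hp : |p| < 1) (hz : z ∈ closedBall (0 : ℂ) 1) :
    1 - (p : ℂ) * z ≠ 0 := by
  intro hzero
  have hlt : ‖(p : ℂ) * z‖ < 1 := by
    rw [norm_mul, norm_real]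
    exact mul_lt_one_of_nonneg_of_lt_one_left (norm_nonneg _) hp (mem_closedBall_zero_iff.1 hz)
  rw [← sub_eq_zero.1 hzero, norm_one] at hlt
  exact hlt.false

theorem one_sub_ofReal_sq_ne_zero (hp : |p| < 1) : 1 - (p : ℂ) ^ 2 ≠ 0 := by
  rw [sq]
  exact one_sub_mul_ne_zero hp (by simpa using hp.le)

theorem discAut_mem_closedBall (hp : |p| < 1) (hz : z ∈ closedBall (0 : ℂ) 1) :
    discAut p z ∈ closedBall (0 : ℂ) 1 := by
  rw [mem_closedBall_zero_iff, discAut, norm_div,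
    div_le_one (norm_pos_iff.2 (one_sub_mul_ne_zero hp hz)),
    ← sq_le_sq₀ (norm_nonneg _) (norm_nonneg _), ← sub_nonneg, norm_one_sub_mul_sq_sub_norm_sub_sq]
  exact mul_nonneg (sub_nonneg.2 ((sq_lt_one_iff_abs_lt_one p).2 hp).le)
    (sub_nonneg.2 (pow_le_one₀ (norm_nonneg z) (mem_closedBall_zero_iff.1 hz)))

theorem norm_discAut_eq_one_iff (hp : |p| < 1) (hz : z ∈ closedBall (0 : ℂ) 1) :
    ‖discAut p z‖ = 1 ↔ ‖z‖ = 1 := by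
  have hsq : 1 - p ^ 2 ≠ 0 := (sub_pos.2 ((sq_lt_one_iff_abs_lt_one p).2 hp)).ne'
  rw [discAut, norm_div, div_eq_one_iff_eq (norm_ne_zero_iff.2 (one_sub_mul_ne_zero hp hz)),
    eq_comm, ← sq_eq_sq₀ (norm_nonneg _) (norm_nonneg _), ← sub_eq_zero,
    norm_one_sub_mul_sq_sub_norm_sub_sq, mul_eq_zero_iff_left hsq, sub_eq_zero, eq_comm,
    pow_eq_one_iff_of_nonneg (norm_nonneg z) two_ne_zero]

theorem discAut_mem_ball (hp : |p| < 1) (hz : z ∈ ball (0 : ℂ) 1) :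
    discAut p z ∈ ball (0 : ℂ) 1 := by
  have hz' := ball_subset_closedBall hz
  exact mem_ball_zero_iff.2 <| lt_of_le_of_ne
    (mem_closedBall_zero_iff.1 (discAut_mem_closedBall hp hz'))
    fun heq => (mem_ball_zero_iff.1 hz).ne ((norm_discAut_eq_one_iff hp hz').1 heq)

theorem discAut_discAut (hp : |p| < 1) (hz : z ∈ closedBall (0 : ℂ) 1) :
    discAut p (discAut p z) = z := by
  have hdenom := one_sub_mul_ne_zero hp hz
  have hsq := one_sub_ofReal_sq_ne_zero hp
  have hcomp : 1 - (p : ℂ) * discAut p z = (1 - (p : ℂ) ^ 2) / (1 - p * z) := by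
    rw [discAut]
    field_simp
    ring
  rw [discAut, hcomp, discAut, div_div_eq_mul_div, div_eq_iff hsq, sub_mul,
    div_mul_cancel₀ _ hdenom]
  ring

theorem bijOn_discAut (hp : |p| < 1) :
    BijOn (discAut p) (ball 0 1 \ {(p : ℂ)}) (ball 0 1 \ {0}) := by
  have hinv : ∀ z ∈ ball (0 : ℂ) 1, discAut p (discAut p z) = z := fun z hz =>
    discAut_discAut hp (ball_subset_closedBall hz)
  refine InvOn.bijOn (f' := discAut p) ⟨fun z hz => hinv z hz.1, fun v hv => hinv v hv.1⟩
    (fun z hz => ⟨discAut_mem_ball hp hz.1, ?_⟩) (fun v hv => ⟨discAut_mem_ball hp hv.1, ?_⟩)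
  · rintro (hz0 : discAut p z = 0)
    exact hz.2 (by rw [mem_singleton_iff, ← hinv z hz.1, hz0, discAut_zero])
  · rintro (hvp : discAut p v = p)
    exact hv.2 (by rw [mem_singleton_iff, ← hinv v hv.1, hvp, discAut_self])

theorem hasDerivAt_discAut (hp : |p| < 1) (hz : z ∈ ball (0 : ℂ) 1) :
    HasDerivAt (discAut p) (-(1 - (p : ℂ) ^ 2) / (1 - p * z) ^ 2) z := by
  have hdenom : HasDerivAt (fun z : ℂ => 1 - (p : ℂ) * z) (-p) z := by
    simpa using ((hasDerivAt_id z).const_mul (p : ℂ)).const_sub 1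
  refine (((hasDerivAt_id z).const_sub (p : ℂ)).div hdenom
    (one_sub_mul_ne_zero hp (ball_subset_closedBall hz))).congr_deriv ?_
  simp only [id]
  ring

theorem analyticAt_discAut (hp : |p| < 1) (hz : z ∈ ball (0 : ℂ) 1) :
    AnalyticAt ℂ (discAut p) z :=
  (analyticAt_const.sub analyticAt_id).div
    (analyticAt_const.sub (analyticAt_const.mul analyticAt_id))
    (one_sub_mul_ne_zero hp (ball_subset_closedBall hz))

theorem inv_discAut (hzp : z ≠ p) :
    (discAut p z)⁻¹ = p - (1 - (p : ℂ) ^ 2) / (z - p) := by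
  have hne := sub_ne_zero.2 hzp
  have hne' := sub_ne_zero.2 hzp.symm
  rw [discAut, inv_div]
  field_simp
  ring

end DiscAut

section Laurent

variable {p : ℝ} {f H : ℂ → ℂ}

theorem ball_subset_ball_zero_one (hp0 : 0 ≤ p) : ball (p : ℂ) (1 - p) ⊆ ball (0 : ℂ) 1 :=
  ball_subset_ball' (by simp [abs_of_nonneg hp0])

theorem laurentCoeff_natCast_sub_one (hp0 : 0 ≤ p) (hp1 : p < 1)
    (hH : AnalyticOnNhd ℂ H (ball 0 1))
    (hf : ∀ z ∈ ball (0 : ℂ) 1, z ≠ p → f z = H z / (z - p)) (k : ℕ) :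
    laurentCoeff p ((k : ℤ) - 1) f = iteratedDeriv k H p / (k.factorial : ℂ) := by
  have hr : 0 < (1 - p) / 2 := by linarith
  have hsub : closedBall (p : ℂ) ((1 - p) / 2) ⊆ ball (0 : ℂ) 1 :=
    (closedBall_subset_ball (by linarith)).trans (ball_subset_ball_zero_one hp0)
  have hcauchy := DifferentiableOn.circleIntegral_one_div_sub_center_pow_smul hr k
    (f := H) (c := (p : ℂ)) (hH.differentiableOn.mono hsub)
  have hintegrand : (∮ z in C((p : ℂ), (1 - p) / 2), f z / (z - (p : ℂ)) ^ ((k : ℤ) - 1 + 1)) =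
      ∮ z in C((p : ℂ), (1 - p) / 2), (1 / (z - (p : ℂ)) ^ (k + 1)) • H z := by
    refine circleIntegral.integral_congr hr.le fun z hz => ?_
    have hzp : z ≠ p := ne_of_mem_sphere hz hr.ne'
    rw [hf z (hsub (sphere_subset_closedBall hz)) hzp, sub_add_cancel, zpow_natCast, smul_eq_mul,
      pow_succ', div_div, one_div_mul_eq_div]
  rw [laurentCoeff, hintegrand, hcauchy, smul_eq_mul, ← mul_assoc, ← mul_div_assoc,
    inv_mul_cancel₀ two_pi_I_ne_zero, one_div_mul_eq_div]

theorem hasSum_laurentCoeff (hp0 : 0 ≤ p) (hp1 : p < 1) (hH : AnalyticOnNhd ℂ H (ball 0 1))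
    (hf : ∀ z ∈ ball (0 : ℂ) 1, z ≠ p → f z = H z / (z - p)) {z : ℂ} (hz0 : 0 < ‖z - p‖)
    (hz1 : ‖z - p‖ < 1 - p) :
    HasSum (fun k : ℕ => laurentCoeff p ((k : ℤ) - 1) f * (z - (p : ℂ)) ^ ((k : ℤ) - 1)) (f z) := by
  have hball : z ∈ ball (p : ℂ) (1 - p) := by rwa [mem_ball, dist_eq]
  have hne : z - p ≠ 0 := norm_pos_iff.1 hz0
  have htaylor := hasSum_taylorSeries_on_ball (f := H) (c := (p : ℂ)) (r := 1 - p)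
    (hH.differentiableOn.mono (ball_subset_ball_zero_one hp0)) hball
  rw [hf z (ball_subset_ball_zero_one hp0 hball) (sub_ne_zero.1 hne)]
  refine (htaylor.div_const (z - p)).congr_fun fun k => ?_
  rw [laurentCoeff_natCast_sub_one hp0 hp1 hH hf, zpow_sub_one₀ hne, zpow_natCast]
  simp only [smul_eq_mul]
  ring

theorem laurentCoeff_one_eq_deriv (hp0 : 0 ≤ p) (hp1 : p < 1) {r : ℂ} {R : ℂ → ℂ}
    (hR : AnalyticOnNhd ℂ R (ball 0 1))
    (hf : ∀ z ∈ ball (0 : ℂ) 1, z ≠ p → f z = r / (z - p) + R z) :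
    laurentCoeff p 1 f = deriv R p := by
  have hmem : (p : ℂ) ∈ ball (0 : ℂ) 1 := by simpa [abs_of_nonneg hp0] using hp1
  have hlinear : ∀ z, HasDerivAt (fun z : ℂ => z - p) 1 z := fun z => (hasDerivAt_id z).sub_const _
  have hfirst : ∀ z ∈ ball (0 : ℂ) 1,
      HasDerivAt (fun z => r + (z - p) * R z) (R z + (z - p) * deriv R z) z := fun z hz =>
    (((hlinear z).fun_mul (hR z hz).differentiableAt.hasDerivAt).const_add r).congr_deriv
      (by rw [one_mul])
  have hsecond : HasDerivAt (fun z => R z + (z - p) * deriv R z) (2 * deriv R p) p :=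
    ((hR p hmem).differentiableAt.hasDerivAt.fun_add ((hlinear p).fun_mul
      (hR p hmem).deriv.differentiableAt.hasDerivAt)).congr_deriv (by ring)
  have hcoeff := laurentCoeff_natCast_sub_one (f := f) (H := fun z => r + (z - p) * R z) hp0 hp1
    (fun z hz => analyticAt_const.add ((analyticAt_id.sub analyticAt_const).mul (hR z hz)))
    (fun z hz hzp => by
      rw [hf z hz hzp, add_div, mul_div_cancel_left₀ _ (sub_ne_zero.2 hzp)]) 2
  have hderiv : deriv (fun z => r + (z - p) * R z) =ᶠ[𝓝 (p : ℂ)]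
      fun z => R z + (z - p) * deriv R z := by
    filter_upwards [isOpen_ball.mem_nhds hmem] with z hz using (hfirst z hz).deriv
  rw [iteratedDeriv_succ, iteratedDeriv_one, hderiv.deriv_eq, hsecond.deriv] at hcoeff
  norm_num at hcoeff
  exact hcoeff

theorem laurentCoeff_one_eq_mul_div (hp0 : 0 ≤ p) (hp1 : p < 1) {b : ℂ} {g : ℂ → ℂ}
    (hg : AnalyticOnNhd ℂ g (ball 0 1))
    (hf : EqOn f (fun z => b * exterior g (discAut p z)) (ball 0 1 \ {(p : ℂ)})) :
    laurentCoeff p 1 f = -(b * deriv g 0) / (1 - (p : ℂ) ^ 2) := by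
  have hp : |p| < 1 := by rwa [abs_of_nonneg hp0]
  have hmem : (p : ℂ) ∈ ball (0 : ℂ) 1 := by simpa using hp
  have hsq := one_sub_ofReal_sq_ne_zero hp
  rw [laurentCoeff_one_eq_deriv (r := -(b * (1 - (p : ℂ) ^ 2)))
    (R := fun z => b * g (discAut p z) + b * p) hp0 hp1 (fun z hz => ?_) (fun z hz hzp => ?_)]
  · have hgp : HasDerivAt g (deriv g 0) (discAut p p) := by
      rw [discAut_self]
      exact (hg 0 (mem_ball_self one_pos)).differentiableAt.hasDerivAt
    refine (((hgp.comp (p : ℂ) (hasDerivAt_discAut hp hmem)).const_mul b).add_const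
      (b * p)).deriv.trans ?_
    rw [← sq]
    field_simp
  · exact (analyticAt_const.mul ((hg _ (discAut_mem_ball hp hz)).fun_comp
      (analyticAt_discAut hp hz))).add analyticAt_const
  · simp only [hf ⟨hz, hzp⟩, exterior, inv_discAut hzp]
    ring

end Laurent

section Sphere

variable {f : ℂ → ℂ} {U : Set ℂ} {a : ℂ}

theorem toSphere_of_order_neg {z : ℂ} (hz : meromorphicOrderAt f z < 0) :
    toSphere f z = OnePoint.infty :=
  if_pos hz

theorem eqOn_toSphere_coe (hpole : ∀ z ∈ U, meromorphicOrderAt f z < 0 ↔ z = a) :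
    EqOn (toSphere f) (fun z => (f z : OnePoint ℂ)) (U \ {a}) := fun z hz =>
  if_neg fun hneg => hz.2 ((hpole z hz.1).1 hneg)

theorem injOn_toSphere_iff (ha : a ∈ U) (hpole : ∀ z ∈ U, meromorphicOrderAt f z < 0 ↔ z = a) :
    InjOn (toSphere f) U ↔ InjOn f (U \ {a}) := by
  have hfinite := eqOn_toSphere_coe hpole
  have hnotMem : toSphere f a ∉ toSphere f '' (U \ {a}) := by
    rw [hfinite.image_eq, toSphere_of_order_neg ((hpole a ha).2 rfl)]
    rintro ⟨z, -, hz⟩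
    exact OnePoint.coe_ne_infty _ hz
  rw [← insert_sdiff_self_of_mem ha, injOn_insert (fun h => h.2 rfl), hfinite.injOn_iff,
    and_iff_left hnotMem, insert_sdiff_self_of_mem ha]
  exact ⟨fun h => InjOn.of_comp h, OnePoint.coe_injective.comp_injOn⟩

theorem compl_image_toSphere (ha : a ∈ U) (hpole : ∀ z ∈ U, meromorphicOrderAt f z < 0 ↔ z = a) :
    (toSphere f '' U)ᶜ = (fun w : ℂ => (w : OnePoint ℂ)) '' (f '' (U \ {a}))ᶜ := by
  rw [← insert_sdiff_self_of_mem ha, image_insert_eq, (eqOn_toSphere_coe hpole).image_eq,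
    toSphere_of_order_neg ((hpole a ha).2 rfl), insert_sdiff_self_of_mem ha,
    ← image_image (fun w : ℂ => (w : OnePoint ℂ)) f, ← union_singleton, compl_eq_comm,
    OnePoint.compl_image_coe, compl_compl]

theorem exists_convex_compl_image_toSphere_iff (ha : a ∈ U)
    (hpole : ∀ z ∈ U, meromorphicOrderAt f z < 0 ↔ z = a) :
    (∃ K : Set ℂ, Convex ℝ K ∧ (toSphere f '' U)ᶜ = (fun w : ℂ => (w : OnePoint ℂ)) '' K) ↔
      Convex ℝ (f '' (U \ {a}))ᶜ := by
  simp only [compl_image_toSphere ha hpole, OnePoint.coe_injective.image_injective.eq_iff,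
    exists_eq_right']

theorem convex_compl_image_const_mul_iff {b : ℂ} (hb : b ≠ 0) {s : Set ℂ} :
    Convex ℝ ((b * ·) '' s)ᶜ ↔ Convex ℝ sᶜ := by
  rw [← image_compl_eq (mulLeft_bijective₀ b hb)]
  refine ⟨fun h => ?_, fun h => h.linear_image (LinearMap.mulLeft ℝ b)⟩
  rw [← preimage_image_eq sᶜ (mul_right_injective₀ hb)]
  exact h.linear_preimage (LinearMap.mulLeft ℝ b)

end Sphere

section Transport

variable {p : ℝ} {f g : ℂ → ℂ} {b : ℂ}

theorem image_eq_image_exterior (hp : |p| < 1)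
    (hf : EqOn f (fun z => b * exterior g (discAut p z)) (ball 0 1 \ {(p : ℂ)})) :
    f '' (ball 0 1 \ {(p : ℂ)}) = (b * ·) '' (exterior g '' (ball 0 1 \ {0})) := by
  rw [hf.image_eq, ← (bijOn_discAut hp).image_eq, image_image, image_image]

theorem isConcaveExterior_iff (hp : |p| < 1) (hb : b ≠ 0) (hg : AnalyticOnNhd ℂ g (ball 0 1))
    (hf : EqOn f (fun z => b * exterior g (discAut p z)) (ball 0 1 \ {(p : ℂ)})) :
    IsConcaveExterior g ↔
      InjOn f (ball 0 1 \ {(p : ℂ)}) ∧ Convex ℝ (f '' (ball 0 1 \ {(p : ℂ)}))ᶜ := by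
  have hinj : InjOn f (ball 0 1 \ {(p : ℂ)}) ↔ InjOn (exterior g) (ball 0 1 \ {0}) := by
    rw [hf.injOn_iff, ← (bijOn_discAut hp).image_eq, ← (bijOn_discAut hp).injOn.comp_iff]
    exact ⟨fun h => InjOn.of_comp h, (mul_right_injective₀ hb).comp_injOn⟩
  rw [hinj, image_eq_image_exterior hp hf, convex_compl_image_const_mul_iff hb]
  exact ⟨fun h => ⟨h.injOn, h.convex_omitted⟩, fun h => ⟨hg, h.1, h.2⟩⟩

end Transport

theorem mul_exterior_dslope_div {Φ : ℂ → ℂ} {v : ℂ} (hΦ : Φ 0 ≠ 0) (hv : v ≠ 0) :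
    Φ 0 * exterior (fun v => dslope Φ 0 v / Φ 0) v = Φ v / v := by
  rw [exterior, mul_add, mul_div_cancel₀ _ hΦ, dslope_of_ne _ hv, slope_def_field, sub_zero,
    ← div_eq_mul_inv, ← add_div, add_sub_cancel]

namespace IsConcave

variable {p : ℝ} {f : ℂ → ℂ} (hf : IsConcave p f) (hp : |p| < 1)
include hf hp

theorem meromorphicOrderAt_neg_iff {z : ℂ} (hz : z ∈ ball (0 : ℂ) 1) :
    meromorphicOrderAt f z < 0 ↔ z = p := by
  have hpole : meromorphicOrderAt f (p : ℂ) < 0 := by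
    rw [hf.simple_pole]
    decide
  refine ⟨fun hneg => hf.injOn hz (by simpa using hp) ?_, fun h => h ▸ hpole⟩
  rw [toSphere_of_order_neg hneg, toSphere_of_order_neg hpole]

theorem analyticAt {z : ℂ} (hz : z ∈ ball (0 : ℂ) 1) (hzp : z ≠ p) : AnalyticAt ℂ f z :=
  (hf.meromorphic hz).meromorphicOrderAt_nonneg_iff_analyticAt.1 <|
    not_lt.1 fun hneg => hzp ((hf.meromorphicOrderAt_neg_iff hp hz).1 hneg)

theorem exists_eq_div : ∃ H : ℂ → ℂ, AnalyticOnNhd ℂ H (ball 0 1) ∧ H p ≠ 0 ∧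
    ∀ z ∈ ball (0 : ℂ) 1, z ≠ p → f z = H z / (z - p) := by
  have hord : meromorphicOrderAt f (p : ℂ) = ((-1 : ℤ) : WithTop ℤ) := hf.simple_pole
  obtain ⟨R, hR, hR0, hRf⟩ := (meromorphicOrderAt_eq_int_iff
    (hf.meromorphic (z := (p : ℂ)) (by simpa using hp)).meromorphicAt).1 hord
  set H := Function.update (fun z => (z - p) * f z) p (R p) with hH
  have hne : ∀ z, z ≠ (p : ℂ) → H z = (z - p) * f z := fun z hz => Function.update_of_ne hz _ _
  refine ⟨H, fun z hz => ?_, by simpa [hH] using hR0, fun z _ hzp => ?_⟩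
  · rcases eq_or_ne z p with rfl | hzp
    · refine hR.congr ?_
      filter_upwards [eventually_nhdsWithin_iff.1 hRf] with x hx
      rcases eq_or_ne x p with rfl | hxp
      · rw [hH, Function.update_self]
      · rw [hne x hxp, hx hxp, zpow_neg_one, smul_eq_mul,
          mul_inv_cancel_left₀ (sub_ne_zero.2 hxp)]
    · refine ((analyticAt_id.sub (analyticAt_const (v := (p : ℂ)))).mul
        (hf.analyticAt hp hz hzp)).congr ?_
      filter_upwards [isOpen_ne.mem_nhds hzp] with x hx using (hne x hx).symm
  · rw [hne z hzp, mul_div_cancel_left₀ _ (sub_ne_zero.2 hzp)]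

theorem exists_eqOn_exterior : ∃ b ≠ 0, ∃ g, IsConcaveExterior g ∧
    EqOn f (fun z => b * exterior g (discAut p z)) (ball 0 1 \ {(p : ℂ)}) := by
  obtain ⟨H, hH, hH0, hfH⟩ := hf.exists_eq_div hp
  have hsq := one_sub_ofReal_sq_ne_zero hp
  set Φ : ℂ → ℂ := fun v => -(H (discAut p v) * (1 - p * v)) / (1 - (p : ℂ) ^ 2) with hΦ
  have hΦa : AnalyticOnNhd ℂ Φ (ball 0 1) := fun v hv =>
    ((hH _ (discAut_mem_ball hp hv)).fun_comp (analyticAt_discAut hp hv) |>.mul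
      (analyticAt_const.sub (analyticAt_const.mul analyticAt_id))).neg.div analyticAt_const hsq
  have hb : Φ 0 ≠ 0 := by
    simpa [hΦ, discAut_zero] using ⟨hH0, hsq⟩
  have hg : AnalyticOnNhd ℂ (fun v => dslope Φ 0 v / Φ 0) (ball 0 1) := fun v hv =>
    ((differentiableOn_dslope (ball_mem_nhds (0 : ℂ) one_pos)).2
      hΦa.differentiableOn).analyticOnNhd isOpen_ball v hv |>.div analyticAt_const hb
  have hfg : EqOn f (fun z => Φ 0 * exterior (fun v => dslope Φ 0 v / Φ 0) (discAut p z))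
      (ball 0 1 \ {(p : ℂ)}) := fun z hz => by
    have hTz : discAut p z ≠ 0 := ((bijOn_discAut hp).mapsTo hz).2
    have hdenom := one_sub_mul_ne_zero hp (ball_subset_closedBall hz.1)
    have hzp : (p : ℂ) - z ≠ 0 := sub_ne_zero.2 (Ne.symm hz.2)
    simp only [mul_exterior_dslope_div hb hTz]
    simp only [hΦ, hfH z hz.1 hz.2, discAut_discAut hp (ball_subset_closedBall hz.1)]
    rw [discAut, ← neg_sub (p : ℂ) z]
    field_simp
    ring
  refine ⟨Φ 0, hb, _, (isConcaveExterior_iff hp hb hg hfg).2 ⟨?_, ?_⟩, hfg⟩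
  · exact (injOn_toSphere_iff (by simpa using hp)
      fun z hz => hf.meromorphicOrderAt_neg_iff hp hz).1 hf.injOn
  · exact (exists_convex_compl_image_toSphere_iff (by simpa using hp)
      fun z hz => hf.meromorphicOrderAt_neg_iff hp hz).1 hf.convex_compl

end IsConcave

section Ellipse

theorem exists_norm_le_norm_add_eq_mul_eq (s c : ℂ) :
    ∃ u u' : ℂ, ‖u'‖ ≤ ‖u‖ ∧ u + u' = s ∧ u * u' = c := by
  obtain ⟨δ, hδ⟩ := IsAlgClosed.exists_pow_nat_eq (s ^ 2 - 4 * c) (n := 2) two_pos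
  have hadd : (s + δ) / 2 + (s - δ) / 2 = s := by ring
  have hmul : (s + δ) / 2 * ((s - δ) / 2) = c := by linear_combination -hδ / 4
  rcases le_total ‖(s - δ) / 2‖ ‖(s + δ) / 2‖ with hle | hle
  · exact ⟨_, _, hle, hadd, hmul⟩
  · exact ⟨_, _, hle, by rw [add_comm, hadd], by rw [mul_comm, hmul]⟩

theorem norm_sub_two_mul_add_norm_add_two_mul {σ u u' : ℂ} (hσ : σ ^ 2 = u * u') :
    ‖u + u' - 2 * σ‖ + ‖u + u' + 2 * σ‖ = 2 * (‖u‖ + ‖u'‖) := by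
  rcases eq_or_ne u 0 with rfl | hu
  · obtain rfl : σ = 0 := by simpa using hσ
    simp only [mul_zero, sub_zero, add_zero, zero_add, norm_zero, two_mul]
  have hsub : u + u' - 2 * σ = (u - σ) ^ 2 / u := by
    field_simp
    linear_combination -hσ
  have hadd : u + u' + 2 * σ = (u + σ) ^ 2 / u := by
    field_simp
    linear_combination -hσ
  have hparallelogram := parallelogram_law_with_norm ℝ u σ
  have hnorm : ‖σ‖ * ‖σ‖ = ‖u‖ * ‖u'‖ := by rw [← norm_mul, ← sq, hσ, norm_mul]
  rw [hsub, hadd, norm_div, norm_div, norm_pow, norm_pow, ← add_div,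
    div_eq_iff (norm_ne_zero_iff.2 hu)]
  linear_combination hparallelogram + 2 * hnorm

theorem convex_norm_sub_add_norm_sub_le (a a' : ℂ) (r : ℝ) :
    Convex ℝ {y : ℂ | ‖y - a‖ + ‖y - a'‖ ≤ r} := by
  simpa [dist_eq] using ((convexOn_univ_dist a).add (convexOn_univ_dist a')).convex_le r

variable {c : ℂ}

theorem injOn_exterior_const_mul_add (hc : ‖c‖ ≤ 1) (d : ℂ) :
    InjOn (exterior fun v => c * v + d) (ball 0 1 \ {0}) := by
  rintro v ⟨hv, hv0 : v ≠ 0⟩ w ⟨hw, hw0 : w ≠ 0⟩ heq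
  have hfactor : (w - v) * (1 - c * v * w) = 0 := by
    simp only [exterior] at heq
    field_simp at heq
    linear_combination heq
  have hlt := mem_ball_zero_iff.1 (mul_mem_ball (η := c * v)
    (mem_ball_zero_iff.1 (mul_mem_ball hc hv)).le hw)
  refine (sub_eq_zero.1 ((mul_eq_zero.1 hfactor).resolve_right fun hone => ?_)).symm
  rw [← sub_eq_zero.1 hone, norm_one] at hlt
  exact hlt.false

theorem add_add_mem_image_exterior_iff {u u' : ℂ} (hle : ‖u'‖ ≤ ‖u‖) (d : ℂ) :
    u + u' + d ∈ exterior (fun v => u * u' * v + d) '' (ball 0 1 \ {0}) ↔ 1 < ‖u‖ := by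
  constructor
  · rintro ⟨v, ⟨hv, hv0 : v ≠ 0⟩, heq⟩
    have hlarge : ∀ x : ℂ, 1 - x * v = 0 → 1 < ‖x‖ := fun x hx => by
      rw [eq_inv_of_mul_eq_one_left (sub_eq_zero.1 hx).symm, norm_inv]
      exact (one_lt_inv₀ (norm_pos_iff.2 hv0)).2 (mem_ball_zero_iff.1 hv)
    have hfactor : (1 - u * v) * (1 - u' * v) = 0 := by
      simp only [exterior] at heq
      field_simp at heq
      linear_combination heq
    exact (mul_eq_zero.1 hfactor).elim (hlarge u) fun h => (hlarge u' h).trans_le hle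
  · intro hu
    have hu0 : u ≠ 0 := norm_pos_iff.1 (one_pos.trans hu)
    refine ⟨u⁻¹, ⟨?_, inv_ne_zero hu0⟩, ?_⟩
    · rw [mem_ball_zero_iff, norm_inv]
      exact inv_lt_one_of_one_lt₀ hu
    · rw [exterior]
      field_simp
      ring

theorem omitted_const_mul_add {σ : ℂ} (hc : ‖c‖ ≤ 1) (hσ : σ ^ 2 = c) (d : ℂ) :
    omitted (fun v => c * v + d) =
      {w | ‖w - (d + 2 * σ)‖ + ‖w - (d - 2 * σ)‖ ≤ 2 * (1 + ‖c‖)} := by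
  ext w
  obtain ⟨u, u', hle, hadd, rfl⟩ := exists_norm_le_norm_add_eq_mul_eq (w - d) c
  have hw : w = u + u' + d := by rw [hadd, sub_add_cancel]
  have hsum := norm_sub_two_mul_add_norm_add_two_mul hσ
  rw [norm_mul] at hc
  rw [omitted, mem_compl_iff, hw, add_add_mem_image_exterior_iff hle, not_lt, mem_ofPred_eq,
    show u + u' + d - (d + 2 * σ) = u + u' - 2 * σ by ring,
    show u + u' + d - (d - 2 * σ) = u + u' + 2 * σ by ring, hsum, norm_mul]
  constructor <;> intro h <;> nlinarith [norm_nonneg u, norm_nonneg u']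

theorem isConcaveExterior_const_mul_add (hc : ‖c‖ ≤ 1) (d : ℂ) :
    IsConcaveExterior fun v => c * v + d := by
  obtain ⟨σ, hσ⟩ := IsAlgClosed.exists_pow_nat_eq c (n := 2) two_pos
  refine ⟨fun v _ => by fun_prop, injOn_exterior_const_mul_add hc d, ?_⟩
  rw [omitted_const_mul_add hc hσ]
  exact convex_norm_sub_add_norm_sub_le _ _ _

end Ellipse

section Construction

variable {p : ℝ} {f g : ℂ → ℂ} {b : ℂ}

theorem ball_diff_singleton_mem_nhds {z : ℂ} (hz : z ∈ ball (0 : ℂ) 1) (hzp : z ≠ p) :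
    ball (0 : ℂ) 1 \ {(p : ℂ)} ∈ 𝓝 z :=
  (isOpen_ball.sdiff isClosed_singleton).mem_nhds ⟨hz, hzp⟩

theorem exists_eventually_eq_zpow_smul (hp : |p| < 1) (hb : b ≠ 0)
    (hg : AnalyticOnNhd ℂ g (ball 0 1))
    (hf : EqOn f (fun z => b * exterior g (discAut p z)) (ball 0 1 \ {(p : ℂ)})) (hfp : f p = 0) :
    ∃ R : ℂ → ℂ, AnalyticAt ℂ R p ∧ R p ≠ 0 ∧
      ∀ᶠ z in 𝓝 (p : ℂ), f z = (z - p) ^ (-1 : ℤ) • R z := by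
  have hmem : (p : ℂ) ∈ ball (0 : ℂ) 1 := by simpa using hp
  refine ⟨fun z => b * ((z - p) * (p + g (discAut p z)) - (1 - (p : ℂ) ^ 2)),
    analyticAt_const.mul (((analyticAt_id.sub analyticAt_const).mul (analyticAt_const.add
      ((hg _ (discAut_mem_ball hp hmem)).fun_comp (analyticAt_discAut hp hmem)))).sub
        analyticAt_const), ?_, ?_⟩
  · simp only [sub_self, zero_mul, zero_sub]
    exact mul_ne_zero hb (neg_ne_zero.2 (one_sub_ofReal_sq_ne_zero hp))
  · filter_upwards [isOpen_ball.mem_nhds hmem] with z hz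
    rcases eq_or_ne z p with rfl | hzp
    · rw [hfp, sub_self, zpow_neg_one, inv_zero, zero_smul]
    · have hne := sub_ne_zero.2 hzp
      simp only [hf ⟨hz, hzp⟩, exterior, inv_discAut hzp, zpow_neg_one, smul_eq_mul]
      field_simp
      ring

theorem IsConcaveExterior.isConcave (hg : IsConcaveExterior g) (hp : |p| < 1) (hb : b ≠ 0)
    (hf : EqOn f (fun z => b * exterior g (discAut p z)) (ball 0 1 \ {(p : ℂ)})) (hfp : f p = 0)
    (hf0 : f 0 = 0) (hderiv : HasDerivAt f 1 0) : IsConcave p f := by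
  have hmem : (p : ℂ) ∈ ball (0 : ℂ) 1 := by simpa using hp
  obtain ⟨R, hR, hRp, hfR⟩ := exists_eventually_eq_zpow_smul hp hb hg.analytic hf hfp
  have hnormal : MeromorphicNFAt f p := Or.inr ⟨-1, R, hR, hRp, hfR⟩
  have horder : meromorphicOrderAt f (p : ℂ) = -1 :=
    (meromorphicOrderAt_eq_int_iff (n := -1) hnormal.meromorphicAt).2
      ⟨R, hR, hRp, hfR.filter_mono nhdsWithin_le_nhds⟩
  have hanalytic : ∀ z ∈ ball (0 : ℂ) 1, z ≠ p → AnalyticAt ℂ f z := fun z hz hzp =>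
    (analyticAt_const.mul ((hg.analyticOnNhd_exterior _
      ((bijOn_discAut hp).mapsTo ⟨hz, hzp⟩)).fun_comp (analyticAt_discAut hp hz))).congr
        (hf.symm.eventuallyEq_of_mem (ball_diff_singleton_mem_nhds hz hzp))
  have hpole : ∀ z ∈ ball (0 : ℂ) 1, meromorphicOrderAt f z < 0 ↔ z = p := fun z hz => by
    refine ⟨fun hneg => of_not_not fun hzp =>
      hneg.not_ge (hanalytic z hz hzp).meromorphicOrderAt_nonneg, ?_⟩
    rintro rfl
    rw [horder]
    decide
  obtain ⟨hinj, hconvex⟩ := (isConcaveExterior_iff hp hb hg.analytic hf).1 hg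
  refine ⟨fun z hz => ?_, horder, hf0, hderiv, (injOn_toSphere_iff hmem hpole).2 hinj,
    (exists_convex_compl_image_toSphere_iff hmem hpole).2 hconvex⟩
  rcases eq_or_ne z p with rfl | hzp
  · exact hnormal
  · exact (hanalytic z hz hzp).meromorphicNFAt

end Construction

section NormalizedCoeff

variable {p : ℝ} {f g : ℂ → ℂ} {b : ℂ}

/-- The affine function of the coefficient `a₁` that takes the disc of the coefficient theorem onto
the closed unit disc. -/
noncomputable def normalizedCoeff (p : ℝ) (w : ℂ) : ℂ :=
  (1 - (p : ℂ) ^ 4) * (w * ((1 - (p : ℂ) ^ 2) / p) ^ 2) + (p : ℂ) ^ 2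

theorem abs_sq_lt_one (hp : |p| < 1) : |p ^ 2| < 1 := by
  rw [abs_pow]
  exact pow_lt_one₀ (abs_nonneg p) hp two_ne_zero

theorem one_sub_pow_four_pos (hp : |p| < 1) : 0 < 1 - p ^ 4 := by
  have hlt := (sq_lt_one_iff_abs_lt_one _).2 (abs_sq_lt_one hp)
  rwa [← pow_mul, ← sub_pos] at hlt

theorem one_sub_ofReal_pow_four_ne_zero (hp : |p| < 1) : 1 - (p : ℂ) ^ 4 ≠ 0 := by
  exact_mod_cast (one_sub_pow_four_pos hp).ne'

theorem norm_mul_sq_add_div_one_sub_pow_four (hp : |p| < 1) (w : ℂ) :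
    ‖w * ((1 - (p : ℂ) ^ 2) / p) ^ 2 + (p : ℂ) ^ 2 / (1 - (p : ℂ) ^ 4)‖ =
      ‖normalizedCoeff p w‖ / (1 - p ^ 4) := by
  have hnorm : ‖1 - (p : ℂ) ^ 4‖ = 1 - p ^ 4 := by
    rw [← Complex.norm_of_nonneg (one_sub_pow_four_pos hp).le]
    push_cast
    rfl
  rw [← hnorm, ← norm_div, normalizedCoeff, add_div,
    mul_div_cancel_left₀ _ (one_sub_ofReal_pow_four_ne_zero hp)]

theorem normalizedCoeff_bijective (hp0 : p ≠ 0) (hp : |p| < 1) :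
    Function.Bijective (normalizedCoeff p) := by
  have hscale : ((1 - (p : ℂ) ^ 2) / p) ^ 2 ≠ 0 :=
    pow_ne_zero 2 (div_ne_zero (one_sub_ofReal_sq_ne_zero hp) (ofReal_ne_zero.2 hp0))
  exact (AddGroup.addRight_bijective _).comp
    ((mulLeft_bijective₀ _ (one_sub_ofReal_pow_four_ne_zero hp)).comp
      (mulRight_bijective₀ _ hscale))

theorem hasDerivAt_exterior {v g' : ℂ} (hv : v ≠ 0) (hg : HasDerivAt g g' v) :
    HasDerivAt (exterior g) (-(v ^ 2)⁻¹ + g') v :=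
  (hasDerivAt_inv hv).fun_add hg

theorem mul_one_sub_sq_mul_deriv_eq_sq (hp0 : p ≠ 0) (hp : |p| < 1)
    (hg : AnalyticOnNhd ℂ g (ball 0 1))
    (hf : EqOn f (fun z => b * exterior g (discAut p z)) (ball 0 1 \ {(p : ℂ)}))
    (hderiv : HasDerivAt f 1 0) :
    b * (1 - (p : ℂ) ^ 2) * (1 - (p : ℂ) ^ 2 * deriv g p) = (p : ℂ) ^ 2 := by
  have hpc : (p : ℂ) ≠ 0 := ofReal_ne_zero.2 hp0
  have hzero : (0 : ℂ) ∈ ball (0 : ℂ) 1 := mem_ball_self one_pos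
  have hext : HasDerivAt (exterior g) (-((p : ℂ) ^ 2)⁻¹ + deriv g p) (discAut p 0) := by
    rw [discAut_zero]
    exact hasDerivAt_exterior hpc (hg _ (by simpa using hp)).differentiableAt.hasDerivAt
  have hchain := (((hext.comp 0 (hasDerivAt_discAut hp hzero)).const_mul b).congr_of_eventuallyEq
    (hf.eventuallyEq_of_mem (ball_diff_singleton_mem_nhds hzero hpc.symm))).unique hderiv
  rw [mul_zero, sub_zero, one_pow, div_one] at hchain
  field_simp at hchain
  linear_combination hchain

theorem normalizedCoeff_laurentCoeff_one_eq_discAut (hp0 : 0 < p) (hp1 : p < 1)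
    (hg : AnalyticOnNhd ℂ g (ball 0 1))
    (hf : EqOn f (fun z => b * exterior g (discAut p z)) (ball 0 1 \ {(p : ℂ)}))
    (hderiv : HasDerivAt f 1 0) (hne : 1 - (p : ℂ) ^ 2 * (deriv g p - deriv g 0) ≠ 0) :
    normalizedCoeff p (laurentCoeff p 1 f) =
      discAut (p ^ 2) (deriv g 0 / (1 - (p : ℂ) ^ 2 * (deriv g p - deriv g 0))) := by
  have hp : |p| < 1 := by rwa [abs_of_pos hp0]
  have hpc : (p : ℂ) ≠ 0 := ofReal_ne_zero.2 hp0.ne'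
  have hnormalization := mul_one_sub_sq_mul_deriv_eq_sq hp0.ne' hp hg hf hderiv
  have hκ : 1 - (p : ℂ) ^ 2 * deriv g p ≠ 0 := by
    refine right_ne_zero_of_mul (a := b * (1 - (p : ℂ) ^ 2)) ?_
    rw [hnormalization]
    exact pow_ne_zero 2 hpc
  have hcoeff : laurentCoeff p 1 f * ((1 - (p : ℂ) ^ 2) / p) ^ 2 =
      -deriv g 0 / (1 - (p : ℂ) ^ 2 * deriv g p) := by
    rw [laurentCoeff_one_eq_mul_div hp0.le hp1 hg hf]
    field_simp [one_sub_ofReal_sq_ne_zero hp]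
    linear_combination -deriv g 0 * hnormalization
  rw [normalizedCoeff, hcoeff, discAut, ofReal_pow, sub_div' hne,
    ← mul_div_assoc ((p : ℂ) ^ 2), one_sub_div hne, div_div_div_cancel_right₀ hne,
    mul_div_assoc', div_add' _ _ _ hκ]
  congr 1 <;> ring

end NormalizedCoeff

section Parametric

variable {p : ℝ} {f : ℂ → ℂ} {b c d ω : ℂ}

/-- The extremal functions with the unimodular parameter `exp (iθ)` replaced by an arbitrary `ω`.
For `ω` in the closed unit disc they belong to `Co p` and exhaust the coefficient region. -/
noncomputable def parametric (p : ℝ) (ω z : ℂ) : ℂ :=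
  (z - (p : ℂ) / (1 + (p : ℂ) ^ 2) * (1 + ω) * z ^ 2) / ((1 - z / (p : ℂ)) * (1 - z * (p : ℂ)))

theorem parametric_zero (p : ℝ) (ω : ℂ) : parametric p ω 0 = 0 := by
  simp [parametric]

theorem parametric_self (hp0 : p ≠ 0) (ω : ℂ) : parametric p ω p = 0 := by
  rw [parametric, div_self (ofReal_ne_zero.2 hp0), sub_self, zero_mul, div_zero]

theorem hasDerivAt_parametric_zero (p : ℝ) (ω : ℂ) : HasDerivAt (parametric p ω) 1 0 := by
  have hnum : HasDerivAt (fun z : ℂ => z - (p : ℂ) / (1 + (p : ℂ) ^ 2) * (1 + ω) * z ^ 2) 1 0 := by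
    simpa using (hasDerivAt_id (0 : ℂ)).fun_sub
      ((hasDerivAt_pow 2 (0 : ℂ)).const_mul ((p : ℂ) / (1 + (p : ℂ) ^ 2) * (1 + ω)))
  have hdenom : DifferentiableAt ℂ (fun z : ℂ => (1 - z / (p : ℂ)) * (1 - z * (p : ℂ))) 0 := by
    fun_prop
  refine (hnum.fun_div hdenom.hasDerivAt (by simp)).congr_deriv ?_
  simp

theorem one_add_ofReal_sq_ne_zero (p : ℝ) : 1 + (p : ℂ) ^ 2 ≠ 0 := by
  exact_mod_cast (show (1 : ℝ) + p ^ 2 ≠ 0 by positivity)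

theorem one_sub_sq_mul_ne_zero (hp : |p| < 1) (hc : c ∈ closedBall (0 : ℂ) 1) :
    1 - (p : ℂ) ^ 2 * c ≠ 0 := by
  exact_mod_cast one_sub_mul_ne_zero (abs_sq_lt_one hp) hc

theorem div_one_add_sq_mul_one_add_discAut (hp : |p| < 1) (hc : c ∈ closedBall (0 : ℂ) 1) :
    (p : ℂ) / (1 + (p : ℂ) ^ 2) * (1 + discAut (p ^ 2) c) = p * (1 - c) / (1 - p ^ 2 * c) := by
  have hsq := one_add_ofReal_sq_ne_zero p
  have hdenom := one_sub_sq_mul_ne_zero hp hc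
  rw [discAut, ofReal_pow, one_add_div hdenom, div_mul_div_comm,
    div_eq_div_iff (mul_ne_zero hsq hdenom) hdenom]
  ring

theorem eqOn_parametric_exterior (hp0 : p ≠ 0) (hp : |p| < 1) (hc : c ∈ closedBall (0 : ℂ) 1) :
    EqOn (parametric p (discAut (p ^ 2) c))
      (fun z => (p : ℂ) ^ 2 / ((1 - (p : ℂ) ^ 2) * (1 - p ^ 2 * c)) *
        exterior (fun v => c * v + -((p : ℂ)⁻¹ + c * p)) (discAut p z))
      (ball 0 1 \ {(p : ℂ)}) := by
  rintro z ⟨hz, hzp : z ≠ p⟩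
  have hpc : (p : ℂ) ≠ 0 := ofReal_ne_zero.2 hp0
  have hdenom := one_sub_sq_mul_ne_zero hp hc
  have hsq := one_sub_ofReal_sq_ne_zero hp
  have hpz := one_sub_mul_ne_zero hp (ball_subset_closedBall hz)
  have hne : (p : ℂ) - z ≠ 0 := sub_ne_zero.2 hzp.symm
  have hpole : (1 - z / (p : ℂ)) * (1 - z * p) = (p - z) * (1 - p * z) / p := by
    field_simp
  simp only [parametric, exterior]
  rw [div_one_add_sq_mul_one_add_discAut hp hc, hpole, discAut, inv_div]
  generalize hx : 1 - (p : ℂ) ^ 2 * c = x at *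
  generalize hs : 1 - (p : ℂ) ^ 2 = s at *
  generalize hn : 1 - (p : ℂ) * z = n at *
  generalize hm : (p : ℂ) - z = m at *
  field_simp
  rw [← hx, ← hs, ← hn, ← hm]
  ring

theorem deriv_const_mul_add_const (c d v : ℂ) : deriv (fun v => c * v + d) v = c := by
  simp

theorem eqOn_parametric_of_eqOn_exterior (hp0 : p ≠ 0) (hp : |p| < 1)
    (hc : c ∈ closedBall (0 : ℂ) 1)
    (hf : EqOn f (fun z => b * exterior (fun v => c * v + d) (discAut p z))
      (ball 0 1 \ {(p : ℂ)})) (hf0 : f 0 = 0) (hderiv : HasDerivAt f 1 0) :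
    EqOn f (parametric p (discAut (p ^ 2) c)) (ball 0 1 \ {(p : ℂ)}) := by
  have hpc : (p : ℂ) ≠ 0 := ofReal_ne_zero.2 hp0
  have hdenom : (1 - (p : ℂ) ^ 2) * (1 - p ^ 2 * c) ≠ 0 :=
    mul_ne_zero (one_sub_ofReal_sq_ne_zero hp) (one_sub_sq_mul_ne_zero hp hc)
  have hnormalization := mul_one_sub_sq_mul_deriv_eq_sq hp0 hp (fun v _ => by fun_prop) hf hderiv
  rw [deriv_const_mul_add_const, mul_assoc, ← eq_div_iff hdenom] at hnormalization
  have hd : d = -((p : ℂ)⁻¹ + c * p) := by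
    have hzero := hf ⟨mem_ball_self one_pos, hpc.symm⟩
    simp only [hf0, discAut_zero, exterior] at hzero
    have hb : b ≠ 0 := by
      rw [hnormalization]
      exact div_ne_zero (pow_ne_zero 2 hpc) hdenom
    linear_combination (mul_eq_zero.1 hzero.symm).resolve_left hb
  rw [hnormalization, hd] at hf
  exact hf.trans (eqOn_parametric_exterior hp0 hp hc).symm

theorem isConcave_parametric (hp0 : p ≠ 0) (hp : |p| < 1) (hω : ω ∈ closedBall (0 : ℂ) 1) :
    IsConcave p (parametric p ω) := by
  have hc := discAut_mem_closedBall (abs_sq_lt_one hp) hω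
  have heq := eqOn_parametric_exterior hp0 hp hc
  rw [discAut_discAut (abs_sq_lt_one hp) hω] at heq
  exact (isConcaveExterior_const_mul_add (mem_closedBall_zero_iff.1 hc) _).isConcave hp
    (div_ne_zero (pow_ne_zero 2 (ofReal_ne_zero.2 hp0)) (mul_ne_zero
      (one_sub_ofReal_sq_ne_zero hp) (one_sub_sq_mul_ne_zero hp hc)))
    heq (parametric_self hp0 ω) (parametric_zero p ω) (hasDerivAt_parametric_zero p ω)

theorem normalizedCoeff_laurentCoeff_one_of_eqOn_parametric (hp0 : 0 < p) (hp1 : p < 1)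
    (hω : ω ∈ closedBall (0 : ℂ) 1) (hf : EqOn f (parametric p ω) (ball 0 1 \ {(p : ℂ)})) :
    normalizedCoeff p (laurentCoeff p 1 f) = ω := by
  have hp : |p| < 1 := by rwa [abs_of_pos hp0]
  have hderiv : HasDerivAt f 1 0 := (hasDerivAt_parametric_zero p ω).congr_of_eventuallyEq
    (hf.eventuallyEq_of_mem (ball_diff_singleton_mem_nhds (mem_ball_self one_pos)
      (ofReal_ne_zero.2 hp0.ne').symm))
  have heq := eqOn_parametric_exterior hp0.ne' hp (discAut_mem_closedBall (abs_sq_lt_one hp) hω)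
  rw [discAut_discAut (abs_sq_lt_one hp) hω] at heq
  have hcoeff := normalizedCoeff_laurentCoeff_one_eq_discAut hp0 hp1 (fun v _ => by fun_prop)
    (hf.trans heq) hderiv
  simp only [deriv_const_mul_add_const, sub_self, mul_zero, sub_zero, div_one,
    discAut_discAut (abs_sq_lt_one hp) hω] at hcoeff
  exact hcoeff one_ne_zero

end Parametric

section CoefficientDisc

variable {p : ℝ} {f g : ℂ → ℂ}

namespace IsConcaveExterior

variable (h : IsConcaveExterior g)
include h

theorem norm_deriv_zero_add_le {v : ℂ} (hv : ‖v‖ ≤ 1 / 2) :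
    ‖deriv g 0‖ + (1 - ‖deriv g 0‖) / 3 ≤ ‖1 - v ^ 2 * (deriv g v - deriv g 0)‖ := by
  have hreverse := norm_sub_norm_le 1 (v ^ 2 * (deriv g v - deriv g 0))
  rw [norm_one] at hreverse
  linarith [h.norm_sq_mul_deriv_sub_le hv]

theorem one_sub_sq_mul_deriv_sub_ne_zero {v : ℂ} (hv : ‖v‖ ≤ 1 / 2) :
    1 - v ^ 2 * (deriv g v - deriv g 0) ≠ 0 :=
  norm_pos_iff.1 <| by linarith [h.norm_deriv_zero_add_le hv, norm_nonneg (deriv g 0)]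

theorem deriv_zero_div_mem_closedBall {v : ℂ} (hv : ‖v‖ ≤ 1 / 2) :
    deriv g 0 / (1 - v ^ 2 * (deriv g v - deriv g 0)) ∈ closedBall (0 : ℂ) 1 := by
  rw [mem_closedBall_zero_iff, norm_div,
    div_le_one (norm_pos_iff.2 (h.one_sub_sq_mul_deriv_sub_ne_zero hv))]
  linarith [h.norm_deriv_zero_add_le hv, h.norm_deriv_zero_le_one]

theorem norm_deriv_zero_eq_one {v : ℂ} (hv : ‖v‖ ≤ 1 / 2)
    (hone : ‖deriv g 0 / (1 - v ^ 2 * (deriv g v - deriv g 0))‖ = 1) : ‖deriv g 0‖ = 1 := by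
  rw [norm_div, div_eq_one_iff_eq (norm_ne_zero_iff.2 (h.one_sub_sq_mul_deriv_sub_ne_zero hv))]
    at hone
  linarith [h.norm_deriv_zero_add_le hv, h.norm_deriv_zero_le_one]

theorem exists_eqOn_const_mul_add (hone : ‖deriv g 0‖ = 1) :
    ∃ d, EqOn g (fun v => deriv g 0 * v + d) (ball 0 1) := by
  have hconst := h.deriv_eqOn_const_of_norm_deriv_zero_eq_one hone
  have hlinear : ∀ v ∈ ball (0 : ℂ) 1, HasDerivAt (fun v => g v - deriv g 0 * v) 0 v := fun v hv =>
    ((h.analytic v hv).differentiableAt.hasDerivAt.fun_sub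
      ((hasDerivAt_id v).const_mul (deriv g 0))).congr_deriv (by rw [hconst hv, mul_one, sub_self])
  obtain ⟨d, hd⟩ := isOpen_ball.exists_is_const_of_deriv_eq_zero
    (convex_ball (0 : ℂ) 1).isPreconnected
    (fun v hv => (hlinear v hv).differentiableAt.differentiableWithinAt)
    (fun v hv => (hlinear v hv).deriv)
  exact ⟨d, fun v hv => sub_eq_iff_eq_add'.1 (hd v hv)⟩

end IsConcaveExterior

namespace IsConcave

variable (hf : IsConcave p f) (hp0 : 0 < p) (hp : p ≤ 1 / 2)
include hf hp0 hp

theorem exists_normalizedCoeff_eq_discAut : ∃ b g, IsConcaveExterior g ∧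
    EqOn f (fun z => b * exterior g (discAut p z)) (ball 0 1 \ {(p : ℂ)}) ∧
    normalizedCoeff p (laurentCoeff p 1 f) =
      discAut (p ^ 2) (deriv g 0 / (1 - (p : ℂ) ^ 2 * (deriv g p - deriv g 0))) := by
  have hp1 : p < 1 := by linarith
  obtain ⟨b, -, g, hg, hfg⟩ := hf.exists_eqOn_exterior (by rwa [abs_of_pos hp0])
  exact ⟨b, g, hg, hfg, normalizedCoeff_laurentCoeff_one_eq_discAut hp0 hp1 hg.analytic hfg
    hf.deriv_zero (hg.one_sub_sq_mul_deriv_sub_ne_zero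
      (by rwa [norm_real, Real.norm_of_nonneg hp0.le]))⟩

theorem norm_normalizedCoeff_le_one : ‖normalizedCoeff p (laurentCoeff p 1 f)‖ ≤ 1 := by
  have habs : |p| < 1 := by rw [abs_of_pos hp0]; linarith
  obtain ⟨b, g, hg, -, hcoeff⟩ := hf.exists_normalizedCoeff_eq_discAut hp0 hp
  rw [hcoeff, ← mem_closedBall_zero_iff]
  exact discAut_mem_closedBall (abs_sq_lt_one habs)
    (hg.deriv_zero_div_mem_closedBall (by rwa [norm_real, Real.norm_of_nonneg hp0.le]))

theorem eqOn_parametric_normalizedCoeff (hone : ‖normalizedCoeff p (laurentCoeff p 1 f)‖ = 1) :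
    EqOn f (parametric p (normalizedCoeff p (laurentCoeff p 1 f))) (ball 0 1 \ {(p : ℂ)}) := by
  have habs : |p| < 1 := by rw [abs_of_pos hp0]; linarith
  have hnorm : ‖(p : ℂ)‖ ≤ 1 / 2 := by rwa [norm_real, Real.norm_of_nonneg hp0.le]
  obtain ⟨b, g, hg, hfg, hcoeff⟩ := hf.exists_normalizedCoeff_eq_discAut hp0 hp
  rw [hcoeff, norm_discAut_eq_one_iff (abs_sq_lt_one habs)
    (hg.deriv_zero_div_mem_closedBall hnorm)] at hone
  have hderiv := hg.norm_deriv_zero_eq_one hnorm hone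
  have hconst : deriv g p = deriv g 0 :=
    hg.deriv_eqOn_const_of_norm_deriv_zero_eq_one hderiv (by simpa using habs)
  obtain ⟨d, hd⟩ := hg.exists_eqOn_const_mul_add hderiv
  rw [hcoeff, hconst, sub_self, mul_zero, sub_zero, div_one]
  refine eqOn_parametric_of_eqOn_exterior (b := b) (d := d) hp0.ne' habs
    (mem_closedBall_zero_iff.2 hderiv.le) (fun z hz => ?_) hf.map_zero hf.deriv_zero
  simp only [hfg hz, exterior, hd (discAut_mem_ball habs hz.1)]

end IsConcave

theorem image_laurentCoeff_one_Co (hp0 : 0 < p) (hp : p ≤ 1 / 2) :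
    laurentCoeff p 1 '' Co p = {w | ‖normalizedCoeff p w‖ ≤ 1} := by
  have hp1 : p < 1 := by linarith
  have habs : |p| < 1 := by rwa [abs_of_pos hp0]
  refine Subset.antisymm ?_ fun w hw => ?_
  · rintro _ ⟨f, hf, rfl⟩
    exact IsConcave.norm_normalizedCoeff_le_one hf hp0 hp
  · have hmem := mem_closedBall_zero_iff.2 hw
    exact ⟨parametric p (normalizedCoeff p w), isConcave_parametric hp0.ne' habs hmem,
      (normalizedCoeff_bijective hp0.ne' habs).1 <|
        normalizedCoeff_laurentCoeff_one_of_eqOn_parametric hp0 hp1 hmem (eqOn_refl _ _)⟩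

theorem norm_eq_one_iff_exists_exp {ω : ℂ} :
    ‖ω‖ = 1 ↔ ∃ θ ∈ Icc (0 : ℝ) (2 * Real.pi), exp (I * θ) = ω := by
  refine ⟨fun hω => ?_, ?_⟩
  · obtain ⟨t, rfl⟩ := (norm_eq_one_iff ω).1 hω
    have hperiodic : Function.Periodic (fun θ : ℝ => exp (I * θ)) (2 * Real.pi) := fun θ => by
      simp only [mul_comm I, ofReal_add, add_mul, ofReal_mul, ofReal_ofNat]
      exact exp_periodic _
    obtain ⟨θ, hθ, hexp⟩ := hperiodic.exists_mem_Ico₀ Real.two_pi_pos t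
    exact ⟨θ, Ico_subset_Icc_self hθ, by rw [← hexp, mul_comm]⟩
  · rintro ⟨θ, -, rfl⟩
    exact norm_exp_I_mul_ofReal θ

theorem IsConcave.norm_normalizedCoeff_eq_one_iff (hf : IsConcave p f) (hp0 : 0 < p)
    (hp : p ≤ 1 / 2) : ‖normalizedCoeff p (laurentCoeff p 1 f)‖ = 1 ↔
      ∃ θ ∈ Icc (0 : ℝ) (2 * Real.pi), ∀ z ∈ ball (0 : ℂ) 1, z ≠ p → f z = extremal p θ z := by
  refine ⟨fun hone => ?_, ?_⟩
  · obtain ⟨θ, hθ, hω⟩ := norm_eq_one_iff_exists_exp.1 hone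
    refine ⟨θ, hθ, fun z hz hzp => ?_⟩
    rw [hf.eqOn_parametric_normalizedCoeff hp0 hp hone ⟨hz, hzp⟩, ← hω]
    rfl
  · rintro ⟨θ, -, hθ⟩
    have hnorm := norm_exp_I_mul_ofReal θ
    rw [normalizedCoeff_laurentCoeff_one_of_eqOn_parametric hp0 (by linarith)
      (mem_closedBall_zero_iff.2 hnorm.le) fun z hz => hθ z hz.1 hz.2, hnorm]

end CoefficientDisc

end ConcaveUnivalent

theorem theorem4_general (p : ℝ) (hp0 : 0 < p) (hp : p ≤ 1 / 2) :
    (∀ f ∈ ConcaveUnivalent.Co p, ∀ z : ℂ, 0 < ‖z - (p : ℂ)‖ → ‖z - (p : ℂ)‖ < 1 - p →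
      HasSum (fun k : ℕ => ConcaveUnivalent.laurentCoeff p ((k : ℤ) - 1) f *
        (z - (p : ℂ)) ^ ((k : ℤ) - 1)) (f z)) ∧
    ConcaveUnivalent.laurentCoeff p 1 '' ConcaveUnivalent.Co p =
      {w : ℂ | ‖w * ((1 - (p : ℂ) ^ 2) / (p : ℂ)) ^ 2 + (p : ℂ) ^ 2 / (1 - (p : ℂ) ^ 4)‖
        ≤ 1 / (1 - p ^ 4)} ∧
    ∀ f ∈ ConcaveUnivalent.Co p,
      (‖ConcaveUnivalent.laurentCoeff p 1 f * ((1 - (p : ℂ) ^ 2) / (p : ℂ)) ^ 2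
          + (p : ℂ) ^ 2 / (1 - (p : ℂ) ^ 4)‖ = 1 / (1 - p ^ 4) ↔
        ∃ θ ∈ Set.Icc (0 : ℝ) (2 * Real.pi), ∀ z ∈ Metric.ball (0 : ℂ) 1, z ≠ (p : ℂ) →
          f z = ConcaveUnivalent.extremal p θ z) := by
  have hp1 : p < 1 := by linarith
  have habs : |p| < 1 := by rwa [abs_of_pos hp0]
  have hpos := ConcaveUnivalent.one_sub_pow_four_pos habs
  simp only [ConcaveUnivalent.norm_mul_sq_add_div_one_sub_pow_four habs,
    div_le_div_iff_of_pos_right hpos, div_left_inj' hpos.ne']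
  refine ⟨fun f hf z hz0 hz1 => ?_, ConcaveUnivalent.image_laurentCoeff_one_Co hp0 hp,
    fun f hf => hf.norm_normalizedCoeff_eq_one_iff hp0 hp⟩
  obtain ⟨H, hH, -, hfH⟩ := hf.exists_eq_div habs
  exact ConcaveUnivalent.hasSum_laurentCoeff hp0.le hp1 hH hfH hz0 hz1

theorem theorem4 (p : ℝ) (hp0 : 0 < p) (hp : p ≤ 1 - Real.sqrt 2 / 2) :
    (∀ f ∈ ConcaveUnivalent.Co p, ∀ z : ℂ, 0 < ‖z - (p : ℂ)‖ → ‖z - (p : ℂ)‖ < 1 - p →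
      HasSum (fun k : ℕ => ConcaveUnivalent.laurentCoeff p ((k : ℤ) - 1) f *
        (z - (p : ℂ)) ^ ((k : ℤ) - 1)) (f z)) ∧
    ConcaveUnivalent.laurentCoeff p 1 '' ConcaveUnivalent.Co p =
      {w : ℂ | ‖w * ((1 - (p : ℂ) ^ 2) / (p : ℂ)) ^ 2 + (p : ℂ) ^ 2 / (1 - (p : ℂ) ^ 4)‖
        ≤ 1 / (1 - p ^ 4)} ∧
    ∀ f ∈ ConcaveUnivalent.Co p,
      (‖ConcaveUnivalent.laurentCoeff p 1 f * ((1 - (p : ℂ) ^ 2) / (p : ℂ)) ^ 2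
          + (p : ℂ) ^ 2 / (1 - (p : ℂ) ^ 4)‖ = 1 / (1 - p ^ 4) ↔
        ∃ θ ∈ Set.Icc (0 : ℝ) (2 * Real.pi), ∀ z ∈ Metric.ball (0 : ℂ) 1, z ≠ (p : ℂ) →
          f z = ConcaveUnivalent.extremal p θ z) := by
  exact theorem4_general p hp0 (hp.trans (by linarith [Real.one_le_sqrt.2 one_le_two]))
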